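/- **Proposition (Effective partition function).** Let $(\mathbb X,\mathcal X)$ be a measurable space, the disjoint union of measurable sets $\mathbb X_s$ (small objects) and $\mathbb X_\ell$ (large objects). Let $v:\mathbb X\times\mathbb X\to[0,\infty]$ be measurable and symmetric, and put $f(x,y)=\mathrm e^{-v(x,y)}-1$ (with $\mathrm e^{-\infty}=0$). Let $\mu$ be a $\sigma$-finite measure on $\mathbb X$, positive, signed or complex (of the form $\mathrm d\mu=z\,\mathrm d\lambda$ with $\lambda$ a positive $\sigma$-finite measure and $z:\mathbb X\to\mathbb C$ measurable, so that $\mathrm d|\mu|=|z|\,\mathrm d\lambda$). For $S\in\mathcal X$ let $$Z_S=1+\sum_{n\ge1}\frac1{n!}\int_{S^n}\prod_{1\le i<j\le n}(1+f(x_i,x_j))\,\mathrm d\mu^n(x).$$ With $\mathcal C_n$ the set of connected graphs with vertex set $\{1,\dots,n\}$, let $\varphi^{\mathsf T}(y_1,\dots,y_n)=\sum_{\gamma\in\mathcal C_n}\prod_{\{i,j\}\in E(\gamma)}f(y_i,y_j)$ be the Ursell functions. Let $\mathbb Y=\bigsqcup_{k\ge1}\mathbb X_s^k$ be the space of clouds,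 with the measure $\nu$ given by $$\int_{\mathbb Y}h\,\mathrm d\nu=\sum_{k\ge1}\frac1{k!}\int_{\mathbb X_s^k}h(y)\,\varphi^{\mathsf T}(y)\,\mathrm d\mu^k(y),$$ and let $\zeta(x,(y_1,\dots,y_k))=\prod_{j=1}^k(1+f(x,y_j))-1$. The effective activity is the measure on $\mathbb X_\ell$ $$\mathrm d\widehat\mu(x)=\mathrm e^{\int_{\mathbb Y}\zeta(x,Y)\,\mathrm d\nu(Y)}\,\mathrm d\mu(x),$$ and the effective multi-body interactions are given, for finite $J$ with $\#J\ge2$ and $\boldsymbol x_J=(x_j)_{j\in J}\in\mathbb X_\ell^J$, by $$-W_{\#J}(\boldsymbol x_J)=\int_{\mathbb Y}\prod_{j\in J}\zeta(x_j,Y)\,\mathrm d\nu(Y).$$ Suppose that for some measurable $c:\mathbb X\to[0,\infty)$ $$\int_{\mathbb X_s}|f(y,y')|\,\mathrm e^{c(y')}\,\mathrm d|\mu|(y')\le c(y)\quad(y\in\mathbb X_s),\qquad \int_{\mathbb X_s}|f(x,y)|\,\mathrm e^{c(y)}\,\mathrm d|\mu|(y)<\infty\quad(x\in\mathbb X_\ell),$$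 and $\int_{\mathbb X_s}\mathrm e^{c(y)}\,\mathrm d|\mu|(y)<\infty$. Then: 1. The integrals and sums defining $\widehat\mu$ (i.e. $\int_{\mathbb Y}\zeta(x,Y)\,\mathrm d\nu(Y)$ for every $x\in\mathbb X_\ell$) and $W_{\#J}(\boldsymbol x_J)$ (for every $\boldsymbol x_J\in\mathbb X_\ell^J$, $\#J\ge2$) converge absolutely. 2. The integrals and the sum defining $Z_{\mathbb X_s}$ converge absolutely and $Z_{\mathbb X_s}\ne0$. If the integrals and the sum defining $Z_{\mathbb X_s\cup\mathbb X_\ell}$ converge absolutely, then $$\frac{Z_{\mathbb X_s\cup\mathbb X_\ell}}{Z_{\mathbb X_s}}=1+\sum_{m\ge1}\frac1{m!}\int_{\mathbb X_\ell^m}\prod_{1\le i<j\le m}(1+f(x_i,x_j))\exp\Bigl(-\sum_{J\subset\{1,\dots,m\},\,\#J\ge2}W_{\#J}(\boldsymbol x_J)\Bigr)\,\mathrm d\widehat\mu^m(\boldsymbol x),$$ and the integrals and the sum on the right converge absolutely. 3. If $\mu$ is nonnegative, then $\widehat\mu$ and the integrand above are nonnegative on $\mathbb X_\ell$, and the identity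 in 2 holds as an identity in $[0,\infty]$ without assuming that $Z_{\mathbb X_s\cup\mathbb X_\ell}$ converges. -/

import Mathlib

open MeasureTheory
open scoped ENNReal NNReal Nat

noncomputable section

namespace TwoScale

/-- A (positive, signed or complex) measure `dμ = density · d base` on `Ω`, given by a positive
reference measure and a complex density. Its total variation may be infinite. A positive measure
is the case `density = 1`; by the polar decomposition `dμ = θ d|μ|` every complex measure is of
this form. -/
structure DensityMeasure (Ω : Type*) [MeasurableSpace Ω] where
  base : Measure Ω
  density : Ω → ℂ

namespace DensityMeasure

variable {Ω : Type*} [MeasurableSpace Ω]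

/-- The total variation measure `|μ|`. -/
def tv (μ : DensityMeasure Ω) : Measure Ω := μ.base.withDensity fun ω => ‖μ.density ω‖ₑ

/-- The restriction of `μ` to a set. -/
def restrict (μ : DensityMeasure Ω) (S : Set Ω) : DensityMeasure Ω :=
  ⟨μ.base.restrict S, μ.density⟩

/-- The product measure `μ^n` on `Ω^n`. -/
def pow (μ : DensityMeasure Ω) (n : ℕ) : DensityMeasure (Fin n → Ω) :=
  ⟨Measure.pi fun _ => μ.base, fun x => ∏ i, μ.density (x i)⟩

/-- The integral `∫ g dμ` (meaningful if `μ.AbsIntegrable g`). -/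
def integral (μ : DensityMeasure Ω) (g : Ω → ℂ) : ℂ := ∫ ω, g ω * μ.density ω ∂μ.base

/-- The integral `∫ |g| d|μ|` in `[0, ∞]`. -/
def absIntegral (μ : DensityMeasure Ω) (g : Ω → ℂ) : ℝ≥0∞ :=
  ∫⁻ ω, ‖g ω * μ.density ω‖ₑ ∂μ.base

/-- Absolute convergence of `∫ g dμ`. -/
def AbsIntegrable (μ : DensityMeasure Ω) (g : Ω → ℂ) : Prop :=
  Integrable (fun ω => g ω * μ.density ω) μ.base

/-- The grand-canonical sum `∑_{n ≥ 0} (1/n!) ∫ F_n dμ^n`. An integral over zero variables is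
evaluation at the empty tuple (see `pow_zero_integral`), so for `F_0 = 1` this is
`1 + ∑_{n ≥ 1} (1/n!) ∫ F_n dμ^n`. -/
def gcSum (μ : DensityMeasure Ω) (F : ∀ n : ℕ, (Fin n → Ω) → ℂ) : ℂ :=
  ∑' n : ℕ, ((n ! : ℕ) : ℂ)⁻¹ * (μ.pow n).integral (F n)

/-- The sum of absolute values `∑_{n ≥ 0} (1/n!) ∫ |F_n| d|μ|^n` in `[0, ∞]`. If `μ` and all
`F_n` are nonnegative it is the value in `[0, ∞]` of the grand-canonical sum itself. -/
def gcAbsSum (μ : DensityMeasure Ω) (F : ∀ n : ℕ, (Fin n → Ω) → ℂ) : ℝ≥0∞ :=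
  ∑' n : ℕ, ((n ! : ℕ) : ℝ≥0∞)⁻¹ * (μ.pow n).absIntegral (F n)

/-- Absolute convergence of the integrals and of the series in `gcSum`. -/
def GCAbsConvergent (μ : DensityMeasure Ω) (F : ∀ n : ℕ, (Fin n → Ω) → ℂ) : Prop :=
  (∀ n, (μ.pow n).AbsIntegrable (F n)) ∧ μ.gcAbsSum F < ∞

theorem pow_zero_integral (μ : DensityMeasure Ω) (g : (Fin 0 → Ω) → ℂ) :
    (μ.pow 0).integral g = g Fin.elim0 := by
  have h : (Fin.elim0 : Fin 0 → Ω) = isEmptyElim := Subsingleton.elim _ _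
  simp [integral, pow, Measure.pi_of_empty (x := (isEmptyElim : Fin 0 → Ω)), h]

end DensityMeasure

variable {X : Type*} [MeasurableSpace X]

/-- Mayer's function `f(x,y) = exp(-v(x,y)) - 1`, with `exp(-∞) = 0`. -/
def mayer (v : X → X → ℝ≥0∞) (x y : X) : ℝ :=
  (if v x y = ∞ then 0 else Real.exp (-(v x y).toReal)) - 1

/-- The Boltzmann factor `∏_{1 ≤ i < j ≤ n} (1 + f(x_i, x_j))`. -/
def boltzmann (v : X → X → ℝ≥0∞) (n : ℕ) (x : Fin n → X) : ℂ :=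
  ∏ p : Fin n × Fin n with p.1 < p.2, ((1 + mayer v (x p.1) (x p.2) : ℝ) : ℂ)

/-- The partition function `Z_S`. -/
def partitionFunction (v : X → X → ℝ≥0∞) (μ : DensityMeasure X) (S : Set X) : ℂ :=
  (μ.restrict S).gcSum (boltzmann v)

open Classical in
/-- The Ursell function: the sum over connected graphs on `n` labelled vertices of the product of
`f(x_i, x_j)` over the edges. -/
def ursell (v : X → X → ℝ≥0∞) (n : ℕ) (x : Fin n → X) : ℝ :=
  ∑ G : SimpleGraph (Fin n) with G.Connected,
    ∏ p : Fin n × Fin n with p.1 < p.2 ∧ G.Adj p.1 p.2, mayer v (x p.1) (x p.2)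

/-- Clouds: the disjoint union of `X^k`, `k ≥ 1`. The chain `⟨k, y⟩` has `k + 1` entries. -/
abbrev Cloud (X : Type*) : Type _ := Σ k : ℕ, (Fin (k + 1) → X)

/-- The measure `ν` on clouds of small objects,
`∫ h dν = ∑_{k ≥ 1} (1/k!) ∫_{Xs^k} h(y) φᵀ(y) dμ^k(y)`. It is concentrated on the chains all of
whose entries lie in `Xs`. -/
def cloudMeasure (v : X → X → ℝ≥0∞) (μ : DensityMeasure X) (Xs : Set X) :
    DensityMeasure (Cloud X) where
  base := Measure.sum fun k : ℕ => (((k + 1)! : ℕ) : ℝ≥0∞)⁻¹ •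
    ((μ.restrict Xs).pow (k + 1)).base.map fun y => (⟨k, y⟩ : Cloud X)
  density Y := (ursell v (Y.1 + 1) Y.2 : ℂ) * ((μ.restrict Xs).pow (Y.1 + 1)).density Y.2

/-- The interaction `ζ(x, Y) = ∏_j (1 + f(x, y_j)) - 1` between an object and a cloud. -/
def zeta (v : X → X → ℝ≥0∞) (x : X) (Y : Cloud X) : ℂ :=
  (((∏ j, (1 + mayer v x (Y.2 j))) - 1 : ℝ) : ℂ)

/-- The effective activity `dμ̂(x) = exp(∫ ζ(x,Y) dν(Y)) dμ(x)` on `Xl`. -/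
def effectiveActivity (v : X → X → ℝ≥0∞) (μ : DensityMeasure X) (Xs Xl : Set X) :
    DensityMeasure X where
  base := μ.base.restrict Xl
  density x := Complex.exp ((cloudMeasure v μ Xs).integral (zeta v x)) * μ.density x

/-- The effective multi-body interaction `W_{#J}(x_J)`, defined by
`-W_{#J}(x_J) = ∫ ∏_{j ∈ J} ζ(x_j, Y) dν(Y)` for a family `x_J = (x_j)_{j ∈ J}`. -/
def multibodyW (v : X → X → ℝ≥0∞) (μ : DensityMeasure X) (Xs : Set X) {J : Type*} [Fintype J]
    (x : J → X) : ℂ :=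
  -(cloudMeasure v μ Xs).integral fun Y => ∏ j, zeta v (x j) Y

/-- The effective Boltzmann factor
`∏_{i < j} (1 + f(x_i,x_j)) · exp(-∑_{J ⊆ [m], #J ≥ 2} W_{#J}(x_J))`. -/
def effectiveBoltzmann (v : X → X → ℝ≥0∞) (μ : DensityMeasure X) (Xs : Set X) (m : ℕ)
    (x : Fin m → X) : ℂ :=
  boltzmann v m x *
    Complex.exp (-∑ J : Finset (Fin m) with 2 ≤ J.card,
      multibodyW v μ Xs fun j : {j // j ∈ J} => x j)

end TwoScale

end

/-! Fix the large objects at x = (x₁, …, x_m) and integrate out the small ones. The large objects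
act on a small object y only through the factor ∏_j (1 + f(x_j, y)), so what remains is a partition
function of small objects with the screened activity z(y) ∏_j (1 + f(x_j, y)). As v ≥ 0, every
factor 1 + f lies in [0, 1]; screening therefore only decreases |z|, and a bound proved for |z|
serves all configurations x at once.

The logarithm of the screened partition function is its cluster expansion, which is the integral of
∏_j (1 + ζ(x_j, Y)) over clouds, because 1 + ζ(x, Y) is multiplicative in the points of Y. Expanding
this product over subsets J of the large objects sorts the exponent: J = ∅ gives log Z of the small
objects alone, singletons give the exponents of the effective activities, and #J ≥ 2 gives the
interactions -W. This is `effectiveBoltzmann_mul_prod`. Summing over large configurations, with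
Fubini for the numbers and positions of both species (`tsum_boltzmannCoeff_eq_screened`), gives the
identity. For nonnegative μ no cancellation occurs in the partition functions, every inequality
between absolute sums becomes an equality, and Tonelli replaces Fubini.

Two analytic facts carry the argument. Convergence (`tsum_rootedIntegral_le`): removing the root
from a connected graph yields a recursion for the Ursell functions, hence a differential inequality
Q' ≤ S' Q for the generating function of rooted clusters. A Grönwall argument and induction on the
order propagate the bound exp(c(y)). Exponentiation (`tsum_boltzmannCoeff_eq_exp`): decomposing a
graph by the component of one vertex turns into Q' = S' Q for the partition function Q and the
cluster series S, so Q = exp S, which in particular is not zero. -/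

noncomputable section

namespace TwoScale

/-! ### Connected graph sums over finite vertex sets -/

section Combinatorics

variable {ι κ : Type*} [LinearOrder ι] [LinearOrder κ]

/-- The unordered pairs of elements of `A`, represented by increasing pairs. -/
def pairs (A : Finset ι) : Finset (ι × ι) := (A ×ˢ A).filter fun p => p.1 < p.2

/-- The product of `1 + f` over the unordered pairs in `A`. -/
def pairProd (f : ι → ι → ℝ) (A : Finset ι) : ℝ := ∏ p ∈ pairs A, (1 + f p.1 p.2)

/-- The edges `E` connect any two vertices of `A`. -/
def Connects (A : Finset ι) (E : Finset (ι × ι)) : Prop :=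
  ∀ i ∈ A, ∀ j ∈ A, Relation.EqvGen (fun i j => (i, j) ∈ E) i j

open Classical in
/-- The sum over connected graphs with vertex set `A` of the product of `f` over the edges. -/
def connSum (f : ι → ι → ℝ) (A : Finset ι) : ℝ :=
  ∑ E ∈ (pairs A).powerset with Connects A E, ∏ p ∈ E, f p.1 p.2

lemma mem_pairs {A : Finset ι} {p : ι × ι} : p ∈ pairs A ↔ p.1 ∈ A ∧ p.2 ∈ A ∧ p.1 < p.2 := by
  simp [pairs, and_assoc]

lemma pairProd_empty (f : ι → ι → ℝ) : pairProd f ∅ = 1 := by simp [pairProd, pairs]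

lemma pairProd_insert {f : ι → ι → ℝ} (hf : ∀ i j, f i j = f j i) {a : ι} {A : Finset ι}
    (ha : a ∉ A) : pairProd f (insert a A) = (∏ i ∈ A, (1 + f a i)) * pairProd f A := by
  have h : pairs (insert a A) =
      A.image (fun i => if a < i then (a, i) else (i, a)) ∪ pairs A := by
    ext ⟨i, j⟩
    simp only [mem_pairs, Finset.mem_insert, Finset.mem_union, Finset.mem_image]
    constructor
    · rintro ⟨rfl | hi, rfl | hj, hij⟩
      · exact absurd hij (lt_irrefl _)
      · exact Or.inl ⟨j, hj, by simp [hij]⟩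
      · exact Or.inl ⟨i, hi, by simp [hij.le]⟩
      · exact Or.inr ⟨hi, hj, hij⟩
    · rintro (⟨k, hk, hk'⟩ | ⟨hi, hj, hij⟩)
      · have hne : a ≠ k := fun h => ha (h ▸ hk)
        split_ifs at hk' with hlt
        · obtain ⟨rfl, rfl⟩ := Prod.mk.inj hk'
          exact ⟨Or.inl rfl, Or.inr hk, hlt⟩
        · obtain ⟨rfl, rfl⟩ := Prod.mk.inj hk'
          exact ⟨Or.inr hk, Or.inl rfl, lt_of_le_of_ne (not_lt.1 hlt) hne.symm⟩
      · exact ⟨Or.inr hi, Or.inr hj, hij⟩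
  have hd : Disjoint (A.image (fun i => if a < i then (a, i) else (i, a))) (pairs A) := by
    rw [Finset.disjoint_left]
    rintro ⟨i, j⟩ h1 h2
    obtain ⟨k, hk, hk'⟩ := Finset.mem_image.1 h1
    rw [mem_pairs] at h2
    split_ifs at hk' with hlt
    · exact ha ((Prod.mk.inj hk').1 ▸ h2.1)
    · exact ha ((Prod.mk.inj hk').2 ▸ h2.2.1)
  rw [pairProd, h, Finset.prod_union hd, Finset.prod_image, pairProd]
  · congr 1
    refine Finset.prod_congr rfl fun i _ => ?_
    split_ifs
    · rfl
    · rw [hf]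
  · intro i hi j hj hij
    dsimp only at hij
    split_ifs at hij <;> simp only [Prod.mk.injEq] at hij <;> aesop

lemma pairProd_map {f : ι → ι → ℝ} (hf : ∀ i j, f i j = f j i) (e : κ ↪ ι) (A : Finset κ) :
    pairProd f (A.map e) = pairProd (fun i j => f (e i) (e j)) A := by
  classical
  induction A using Finset.induction_on with
  | empty => simp [pairProd_empty]
  | insert a A ha ih =>
    rw [Finset.map_insert, pairProd_insert hf (by simpa using ha), ih,
      pairProd_insert (fun i j => hf _ _) ha, Finset.prod_map]

/-- No edge leaves `V`, so a chain of edges starting in `V` stays there and uses only edges between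
vertices of `V`. -/
lemma connects_filter_of_closed {V A : Finset ι} {E : Finset (ι × ι)} (hE : E ⊆ pairs A)
    (hV : ∀ i j, (i, j) ∈ E → (i ∈ V ↔ j ∈ V)) {i j : ι}
    (h : Relation.EqvGen (fun i j => (i, j) ∈ E) i j) :
    (i ∈ V ↔ j ∈ V) ∧ (i ∈ V → Relation.EqvGen (fun i j => (i, j) ∈ E ∩ pairs V) i j) := by
  induction h with
  | rel i j h =>
    refine ⟨hV i j h, fun hi => .rel _ _ (Finset.mem_inter.2 ⟨h, mem_pairs.2 ⟨hi, (hV i j h).1 hi,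
      (mem_pairs.1 (hE h)).2.2⟩⟩)⟩
  | refl i => exact ⟨Iff.rfl, fun _ => .refl _⟩
  | symm i j _ ih => exact ⟨ih.1.symm, fun h => .symm _ _ (ih.2 (ih.1.2 h))⟩
  | trans i j k _ _ ih ih' =>
    exact ⟨ih.1.trans ih'.1, fun h => .trans _ _ _ (ih.2 h) (ih'.2 (ih.1.1 h))⟩

lemma mem_iff_mem_of_eqvGen {α : Type*} {V : Finset α} {E : Finset (α × α)}
    (hV : ∀ i j, (i, j) ∈ E → (i ∈ V ↔ j ∈ V)) {i j : α}
    (h : Relation.EqvGen (fun i j => (i, j) ∈ E) i j) : i ∈ V ↔ j ∈ V := by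
  induction h with
  | rel i j h => exact hV i j h
  | refl i => exact Iff.rfl
  | symm i j _ ih => exact ih.symm
  | trans i j k _ _ ih ih' => exact ih.trans ih'

/-- Decomposition of the graphs on `insert a A` according to the component of `a`. -/
lemma pairProd_insert_eq_sum (f : ι → ι → ℝ) {a : ι} {A : Finset ι} (ha : a ∉ A) :
    pairProd f (insert a A) =
      ∑ U ∈ A.powerset, connSum f (insert a U) * pairProd f (A \ U) := by
  classical
  -- Expanding the product gives one term per edge set `E`; the terms are grouped by the set `U` of
  -- vertices of `A` in the component of `a`.
  rw [pairProd, Finset.prod_one_add, ← Finset.sum_fiberwise_of_maps_to (t := A.powerset)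
    (g := fun E => A.filter fun i => Relation.EqvGen (fun i j => (i, j) ∈ E) a i)
    (fun E _ => by simp)]
  refine Finset.sum_congr rfl fun U hU => ?_
  rw [Finset.mem_powerset] at hU
  rw [connSum, pairProd, Finset.prod_one_add, Finset.sum_mul_sum, ← Finset.sum_product']
  have hsub : pairs (insert a U) ⊆ pairs (insert a A) := fun p hp => by
    rw [mem_pairs] at hp ⊢
    exact ⟨Finset.insert_subset_insert a hU hp.1, Finset.insert_subset_insert a hU hp.2.1, hp.2.2⟩
  have hsub' : pairs (A \ U) ⊆ pairs (insert a A) := fun p hp => by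
    rw [mem_pairs] at hp ⊢
    simp only [Finset.mem_sdiff] at hp
    exact ⟨Finset.mem_insert_of_mem hp.1.1, Finset.mem_insert_of_mem hp.2.1.1, hp.2.2⟩
  have hdisj : Disjoint (pairs (insert a U)) (pairs (A \ U)) := by
    rw [Finset.disjoint_left]
    intro p hp hp'
    rw [mem_pairs] at hp hp'
    have h1 := Finset.mem_sdiff.1 hp'.1
    rcases Finset.mem_insert.1 hp.1 with h | h
    · exact ha (h ▸ h1.1)
    · exact h1.2 h
  -- No edge of `E` joins the component `insert a U` to its complement, so `E` splits into a
  -- connected part and an arbitrary graph on `A \ U`.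
  have fwd : ∀ E ∈ (pairs (insert a A)).powerset.filter (fun E =>
      (A.filter fun i => Relation.EqvGen (fun i j => (i, j) ∈ E) a i) = U),
      E ∩ pairs (insert a U) ∪ E ∩ pairs (A \ U) = E ∧
        Connects (insert a U) (E ∩ pairs (insert a U)) := by
    intro E hE
    rw [Finset.mem_filter, Finset.mem_powerset] at hE
    obtain ⟨hE, hEU⟩ := hE
    set V := insert a U with hVdef
    have hmem : ∀ i, i ∈ V ↔ i ∈ insert a A ∧ Relation.EqvGen (fun i j => (i, j) ∈ E) a i := by
      intro i
      simp only [hVdef, ← hEU, Finset.mem_insert, Finset.mem_filter]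
      constructor
      · rintro (rfl | h)
        · exact ⟨Or.inl rfl, .refl _⟩
        · exact ⟨Or.inr h.1, h.2⟩
      · rintro ⟨rfl | h, h'⟩
        · exact Or.inl rfl
        · exact Or.inr ⟨h, h'⟩
    have hV : ∀ i j, (i, j) ∈ E → (i ∈ V ↔ j ∈ V) := by
      intro i j hij
      have hp := mem_pairs.1 (hE hij)
      rw [hmem, hmem]
      exact ⟨fun h => ⟨hp.2.1, .trans _ _ _ h.2 (.rel _ _ hij)⟩,
        fun h => ⟨hp.1, .trans _ _ _ h.2 (.symm _ _ (.rel _ _ hij))⟩⟩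
    constructor
    · rw [← Finset.inter_union_distrib_left]
      refine Finset.inter_eq_left.2 fun p hp => ?_
      have hp' := mem_pairs.1 (hE hp)
      have hiff := hV p.1 p.2 hp
      rw [Finset.mem_union, mem_pairs, mem_pairs]
      by_cases h : p.1 ∈ V
      · exact Or.inl ⟨h, hiff.1 h, hp'.2.2⟩
      · have h2 : p.2 ∉ V := fun h' => h (hiff.2 h')
        simp only [hVdef, Finset.mem_insert, not_or] at h h2
        refine Or.inr ⟨Finset.mem_sdiff.2 ⟨?_, h.2⟩, Finset.mem_sdiff.2 ⟨?_, h2.2⟩, hp'.2.2⟩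
        · exact (Finset.mem_insert.1 hp'.1).resolve_left h.1
        · exact (Finset.mem_insert.1 hp'.2.1).resolve_left h2.1
    · intro i hi j hj
      have haV : a ∈ V := Finset.mem_insert_self _ _
      have h1 := (connects_filter_of_closed hE hV ((hmem i).1 hi).2).2 haV
      have h2 := (connects_filter_of_closed hE hV ((hmem j).1 hj).2).2 haV
      exact .trans _ _ _ (.symm _ _ h1) h2
  refine Finset.sum_bij' (fun E _ => (E ∩ pairs (insert a U), E ∩ pairs (A \ U)))
    (fun E _ => E.1 ∪ E.2) ?_ ?_ ?_ ?_ ?_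
  · intro E hE
    simp only [Finset.mem_product, Finset.mem_filter, Finset.mem_powerset]
    exact ⟨⟨Finset.inter_subset_right, (fwd E hE).2⟩, Finset.inter_subset_right⟩
  · rintro ⟨E₁, E₂⟩ hE
    simp only [Finset.mem_product, Finset.mem_filter, Finset.mem_powerset] at hE
    obtain ⟨⟨h1, hc⟩, h2⟩ := hE
    rw [Finset.mem_filter, Finset.mem_powerset]
    refine ⟨Finset.union_subset (h1.trans hsub) (h2.trans hsub'), ?_⟩
    ext i
    rw [Finset.mem_filter]
    constructor
    · rintro ⟨hi, hai⟩
      have := (mem_iff_mem_of_eqvGen (V := insert a U) (fun i j hij => ?_) hai).1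
        (Finset.mem_insert_self _ _)
      · exact (Finset.mem_insert.1 this).resolve_left fun h => ha (h ▸ hi)
      · rcases Finset.mem_union.1 hij with h | h
        · have := mem_pairs.1 (h1 h)
          exact iff_of_true this.1 this.2.1
        · have := mem_pairs.1 (h2 h)
          simp only [Finset.mem_sdiff] at this
          refine iff_of_false (fun h' => ?_) (fun h' => ?_)
          · rcases Finset.mem_insert.1 h' with h' | h'
            · exact ha (h' ▸ this.1.1)
            · exact this.1.2 h'
          · rcases Finset.mem_insert.1 h' with h' | h'
            · exact ha (h' ▸ this.2.1.1)
            · exact this.2.1.2 h'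
    · intro hi
      exact ⟨hU hi, (hc a (Finset.mem_insert_self _ _) i (Finset.mem_insert_of_mem hi)).mono
        fun i j h => Finset.mem_union_left _ h⟩
  · exact fun E hE => (fwd E hE).1
  · rintro ⟨E₁, E₂⟩ hE
    simp only [Finset.mem_product, Finset.mem_filter, Finset.mem_powerset] at hE
    obtain ⟨⟨h1, hc⟩, h2⟩ := hE
    ext1
    · simp only [Finset.union_inter_distrib_right, Finset.inter_eq_left.2 h1]
      rw [Finset.disjoint_iff_inter_eq_empty.1 (hdisj.symm.mono_left h2), Finset.union_empty]
    · simp only [Finset.union_inter_distrib_right, Finset.inter_eq_left.2 h2]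
      rw [Finset.disjoint_iff_inter_eq_empty.1 (hdisj.mono_left h1), Finset.empty_union]
  · intro E hE
    rw [← Finset.prod_union (hdisj.mono Finset.inter_subset_right Finset.inter_subset_right),
      (fwd E hE).1]

/-- The term `U = A` of the component decomposition, isolated. Since the other terms involve only
smaller sets, this determines `connSum` recursively from `pairProd`. -/
lemma connSum_insert (f : ι → ι → ℝ) {a : ι} {A : Finset ι} (ha : a ∉ A) :
    connSum f (insert a A) = pairProd f (insert a A) -
      ∑ U ∈ A.ssubsets, connSum f (insert a U) * pairProd f (A \ U) := by
  rw [pairProd_insert_eq_sum f ha, Finset.ssubsets,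
    ← Finset.add_sum_erase _ _ (Finset.mem_powerset_self A)]
  simp [pairProd_empty]

/-- The embedding need not be monotone, so it does not map increasing pairs to increasing pairs, and
a direct bijection of edge sets would have to reorder them. The recursion `connSum_insert` avoids
this, as it reduces the claim to the invariance of `pairProd`. -/
lemma connSum_map_insert {f : ι → ι → ℝ} (hf : ∀ i j, f i j = f j i) (e : κ ↪ ι) {a : κ}
    (A : Finset κ) (ha : a ∉ A) : connSum f ((insert a A).map e) =
      connSum (fun i j => f (e i) (e j)) (insert a A) := by
  classical
  induction A using Finset.strongInduction with
  | H A ih =>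
    rw [connSum_insert _ ha, ← pairProd_map hf, Finset.map_insert,
      connSum_insert _ (by simpa using ha)]
    congr 1
    symm
    refine Finset.sum_bij' (fun U _ => U.map e) (fun U _ => A.filter fun i => e i ∈ U)
      ?_ ?_ ?_ ?_ ?_
    · intro U hU
      rw [Finset.mem_ssubsets] at hU ⊢
      exact Finset.map_ssubset_map.2 hU
    · intro U hU
      rw [Finset.mem_ssubsets] at hU ⊢
      refine ⟨Finset.filter_subset _ _, fun h => hU.2 fun j hj => ?_⟩
      obtain ⟨i, hi, rfl⟩ := Finset.mem_map.1 hj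
      exact (Finset.mem_filter.1 (h hi)).2
    · intro U hU
      rw [Finset.mem_ssubsets] at hU
      ext i
      simpa using fun h => hU.1 h
    · intro U hU
      rw [Finset.mem_ssubsets] at hU
      ext j
      simp only [Finset.mem_map, Finset.mem_filter]
      constructor
      · rintro ⟨i, ⟨_, h⟩, rfl⟩
        exact h
      · intro h
        obtain ⟨i, hi, rfl⟩ := Finset.mem_map.1 (hU.1 h)
        exact ⟨i, ⟨hi, h⟩, rfl⟩
    · intro U hU
      rw [Finset.mem_ssubsets] at hU
      rw [← ih U hU (fun h => ha (hU.1 h)), ← pairProd_map hf, Finset.map_insert, Finset.map_sdiff]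

lemma connSum_map {f : ι → ι → ℝ} (hf : ∀ i j, f i j = f j i) (e : κ ↪ ι) {A : Finset κ}
    (hA : A.Nonempty) : connSum f (A.map e) = connSum (fun i j => f (e i) (e j)) A := by
  classical
  obtain ⟨a, ha⟩ := hA
  rw [← Finset.insert_erase ha]
  exact connSum_map_insert hf e _ (Finset.notMem_erase _ _)

/-- The convolution of set functions over the decompositions of a set into two parts. -/
def setConv (F G : Finset ι → ℝ) (A : Finset ι) : ℝ := ∑ U ∈ A.powerset, F U * G (A \ U)

lemma setConv_comm (F G : Finset ι → ℝ) (A : Finset ι) : setConv F G A = setConv G F A := by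
  refine Finset.sum_bij' (fun U _ => A \ U) (fun U _ => A \ U) ?_ ?_ ?_ ?_ ?_
  · simp
  · simp
  · intro U hU
    exact Finset.sdiff_sdiff_eq_self (Finset.mem_powerset.1 hU)
  · intro U hU
    exact Finset.sdiff_sdiff_eq_self (Finset.mem_powerset.1 hU)
  · intro U hU
    rw [Finset.sdiff_sdiff_eq_self (Finset.mem_powerset.1 hU), mul_comm]

lemma setConv_assoc (F G H : Finset ι → ℝ) (A : Finset ι) :
    setConv (setConv F G) H A = setConv F (setConv G H) A := by
  simp only [setConv, Finset.sum_mul, Finset.mul_sum]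
  rw [Finset.sum_sigma', Finset.sum_sigma']
  refine Finset.sum_bij' (fun p _ => ⟨p.2, p.1 \ p.2⟩) (fun p _ => ⟨p.1 ∪ p.2, p.1⟩)
    ?_ ?_ ?_ ?_ ?_
  · rintro ⟨U, V⟩ h
    simp only [Finset.mem_sigma, Finset.mem_powerset] at h ⊢
    exact ⟨h.2.trans h.1, Finset.sdiff_subset_sdiff h.1 le_rfl⟩
  · rintro ⟨U, V⟩ h
    simp only [Finset.mem_sigma, Finset.mem_powerset] at h ⊢
    exact ⟨Finset.union_subset h.1 (h.2.trans Finset.sdiff_subset), Finset.subset_union_left⟩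
  · rintro ⟨U, V⟩ h
    simp only [Finset.mem_sigma, Finset.mem_powerset] at h ⊢
    simp [Finset.union_eq_right.2 h.2]
  · rintro ⟨U, V⟩ h
    simp only [Finset.mem_sigma, Finset.mem_powerset] at h ⊢
    rw [Finset.union_sdiff_cancel_left]
    exact Finset.disjoint_sdiff.mono_right h.2
  · rintro ⟨U, V⟩ h
    simp only [Finset.mem_sigma, Finset.mem_powerset] at h ⊢
    rw [mul_assoc, Finset.sdiff_sdiff_left', ← Finset.sdiff_union_distrib,
      Finset.union_sdiff_of_subset h.2]

lemma setConv_congr_left {F F' : Finset ι → ℝ} (G : Finset ι → ℝ) {A : Finset ι}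
    (h : ∀ U ⊆ A, F U = F' U) : setConv F G A = setConv F' G A :=
  Finset.sum_congr rfl fun U hU => by rw [h U (Finset.mem_powerset.1 hU)]

lemma setConv_congr_right (F : Finset ι → ℝ) {G G' : Finset ι → ℝ} {A : Finset ι}
    (h : ∀ U ⊆ A, G U = G' U) : setConv F G A = setConv F G' A :=
  Finset.sum_congr rfl fun U _ => by rw [h _ Finset.sdiff_subset]

/-- Cancellation in the convolution algebra: a set function with value 1 at `∅` is invertible. In
the induction the term `U = A` has coefficient `G ∅ = 1` and all others agree already. -/
lemma eq_of_setConv_eq {F F' G : Finset ι → ℝ} (hG : G ∅ = 1) {A : Finset ι}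
    (h : ∀ U ⊆ A, setConv F G U = setConv F' G U) : F A = F' A := by
  induction A using Finset.strongInduction with
  | H A ih =>
    have hA := h A le_rfl
    rw [setConv, setConv, ← Finset.add_sum_erase _ _ (Finset.mem_powerset_self A),
      ← Finset.add_sum_erase _ _ (Finset.mem_powerset_self A)] at hA
    have : ∑ U ∈ A.powerset.erase A, F U * G (A \ U) =
        ∑ U ∈ A.powerset.erase A, F' U * G (A \ U) := by
      refine Finset.sum_congr rfl fun U hU => ?_
      have hU' : U ⊂ A := Finset.mem_ssubsets.1 hU
      rw [ih U hU' fun V hV => h V (hV.trans hU'.1)]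
    rw [this] at hA
    simpa [hG] using add_right_cancel hA

/-- Recursion for connected sums: decompose according to the component of `a` after removal of
the vertex `r`. -/
lemma connSum_insert_insert {f : ι → ι → ℝ} (hf : ∀ i j, f i j = f j i) {r a : ι} {A : Finset ι}
    (hra : r ≠ a) (hr : r ∉ A) (ha : a ∉ A) :
    connSum f (insert r (insert a A)) = ∑ U ∈ A.powerset,
      (((∏ i ∈ insert a U, (1 + f r i)) - 1) * connSum f (insert a U)) *
        connSum f (insert r (A \ U)) := by
  set g : Finset ι → ℝ := fun U => ∏ i ∈ U, (1 + f r i) with hg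
  set B := pairProd f
  set Ca : Finset ι → ℝ := fun U => connSum f (insert a U) with hCa
  set Cr : Finset ι → ℝ := fun U => connSum f (insert r U) with hCr
  set gCa : Finset ι → ℝ := fun U => g (insert a U) * Ca U
  set D : Finset ι → ℝ := fun U => connSum f (insert r (insert a U))
  -- Both sides come from computing `B` on `U ∪ {r, a}` in two ways; the common factor `B` is then
  -- cancelled by `eq_of_setConv_eq`.
  have key : ∀ U ⊆ A, setConv D B U = setConv (setConv (fun U => gCa U - Ca U) Cr) B U := by
    intro U hU
    have hrU : r ∉ U := fun h => hr (hU h)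
    have haU : a ∉ U := fun h => ha (hU h)
    have hr' : r ∉ insert a U := by simp [hra, hrU]
    have hB : ∀ V ⊆ U, B (insert a V) = setConv Ca B V := fun V hV =>
      pairProd_insert_eq_sum f fun h => haU (hV h)
    have hB' : ∀ V ⊆ U, g V * B V = setConv Cr B V := fun V hV => by
      rw [← pairProd_insert hf fun h => hrU (hV h)]
      exact pairProd_insert_eq_sum f fun h => hrU (hV h)
    -- Decomposition by the component of `r`, which either contains `a` (the term with `D`) or does
    -- not.
    have h1 : B (insert r (insert a U)) = setConv D B U + setConv Cr (setConv Ca B) U := by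
      rw [setConv_congr_right Cr fun V hV => (hB V hV).symm]
      rw [show B (insert r (insert a U)) = _ from pairProd_insert_eq_sum f hr',
        Finset.sum_powerset_insert haU, add_comm]
      congr 1
      · refine Finset.sum_congr rfl fun V hV => ?_
        rw [Finset.mem_powerset] at hV
        congr 2
        ext i
        simp only [Finset.mem_sdiff, Finset.mem_insert]
        aesop
      · refine Finset.sum_congr rfl fun V hV => ?_
        rw [Finset.mem_powerset] at hV
        rw [Finset.insert_sdiff_of_notMem _ fun h => haU (hV h)]
    -- Here the factors at `r` are split off first and the rest is decomposed by the component of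
    -- `a`; the factors at `r` distribute over that component and its complement.
    have h2 : B (insert r (insert a U)) = setConv gCa (setConv Cr B) U := by
      rw [show B (insert r (insert a U)) = _ from pairProd_insert hf hr',
        show pairProd f (insert a U) = _ from hB U le_rfl,
        setConv, setConv, Finset.mul_sum]
      refine Finset.sum_congr rfl fun V hV => ?_
      rw [Finset.mem_powerset] at hV
      rw [← hB' _ Finset.sdiff_subset]
      have : (∏ i ∈ insert a U, (1 + f r i)) = g (insert a V) * g (U \ V) := by
        rw [hg, ← Finset.prod_union]
        · congr 1
          rw [Finset.insert_union, Finset.union_sdiff_of_subset hV]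
        · rw [Finset.disjoint_left]
          intro i hi hi'
          rw [Finset.mem_sdiff] at hi'
          rcases Finset.mem_insert.1 hi with rfl | h
          · exact haU hi'.1
          · exact hi'.2 h
      rw [this]
      ring
    have h3 : setConv D B U = setConv gCa (setConv Cr B) U - setConv Cr (setConv Ca B) U := by
      linarith
    rw [h3, setConv_assoc, ← setConv_assoc Cr,
      setConv_congr_left B fun V _ => setConv_comm Cr Ca V, setConv_assoc]
    simp only [setConv, sub_mul, Finset.sum_sub_distrib]
  rw [show connSum f (insert r (insert a A)) = D A from rfl, eq_of_setConv_eq (pairProd_empty f) key]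
  refine Finset.sum_congr rfl fun U _ => ?_
  simp only [gCa, hCa, hCr]
  ring

end Combinatorics

/-! ### Ursell functions and Boltzmann factors as graph sums -/

section Ursell

variable {X : Type*} (v : X → X → ℝ≥0∞)

lemma eqvGen_iff_reachable {n : ℕ} (G : SimpleGraph (Fin n)) {E : Finset (Fin n × Fin n)}
    (h1 : ∀ i j, (i, j) ∈ E → G.Adj i j) (h2 : ∀ i j, G.Adj i j → (i, j) ∈ E ∨ (j, i) ∈ E)
    (i j : Fin n) : Relation.EqvGen (fun i j => (i, j) ∈ E) i j ↔ G.Reachable i j := by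
  constructor
  · intro h
    induction h with
    | rel i j h => exact (h1 i j h).reachable
    | refl i => exact .refl _
    | symm i j _ ih => exact ih.symm
    | trans i j k _ _ ih ih' => exact ih.trans ih'
  · intro h
    rw [SimpleGraph.reachable_iff_reflTransGen] at h
    induction h with
    | refl => exact .refl _
    | tail _ h ih =>
      refine .trans _ _ _ ih ?_
      rcases h2 _ _ h with h | h
      · exact .rel _ _ h
      · exact .symm _ _ (.rel _ _ h)

/-- A graph corresponds to its set of increasing edges. At least one vertex is needed:
`SimpleGraph.Connected` excludes the empty graph, whereas `Connects ∅ ∅` holds. -/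
lemma ursell_eq_connSum (n : ℕ) (x : Fin (n + 1) → X) :
    ursell v (n + 1) x = connSum (fun i j => mayer v (x i) (x j)) Finset.univ := by
  classical
  rw [ursell, connSum]
  refine Finset.sum_bij'
    (fun G _ => Finset.univ.filter fun p : Fin (n + 1) × Fin (n + 1) => p.1 < p.2 ∧ G.Adj p.1 p.2)
    (fun E _ => SimpleGraph.fromRel fun i j => (i, j) ∈ E) ?_ ?_ ?_ ?_ ?_
  · intro G hG
    rw [Finset.mem_filter, Finset.mem_powerset]
    refine ⟨fun p hp => mem_pairs.2 ⟨Finset.mem_univ _, Finset.mem_univ _,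
      (Finset.mem_filter.1 hp).2.1⟩, fun i _ j _ => ?_⟩
    rw [eqvGen_iff_reachable G]
    · exact (Finset.mem_filter.1 hG).2 i j
    · intro i j h
      exact (Finset.mem_filter.1 h).2.2
    · intro i j h
      simp only [Finset.mem_filter, Finset.mem_univ, true_and]
      rcases lt_or_gt_of_ne h.ne with h' | h'
      · exact Or.inl ⟨h', h⟩
      · exact Or.inr ⟨h', h.symm⟩
  · intro E hE
    rw [Finset.mem_filter, Finset.mem_powerset] at hE
    rw [Finset.mem_filter]
    refine ⟨Finset.mem_univ _, ⟨fun i j => ?_⟩⟩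
    rw [← eqvGen_iff_reachable _ (E := E)]
    · exact hE.2 i (Finset.mem_univ _) j (Finset.mem_univ _)
    · intro i j h
      rw [SimpleGraph.fromRel_adj]
      exact ⟨(mem_pairs.1 (hE.1 h)).2.2.ne, Or.inl h⟩
    · intro i j h
      exact ((SimpleGraph.fromRel_adj _ _ _).1 h).2
  · intro G _
    ext i j
    simp only [SimpleGraph.fromRel_adj, Finset.mem_filter, Finset.mem_univ, true_and]
    constructor
    · rintro ⟨_, h | h⟩
      · exact h.2
      · exact h.2.symm
    · intro h
      refine ⟨h.ne, ?_⟩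
      rcases lt_or_gt_of_ne h.ne with h' | h'
      · exact Or.inl ⟨h', h⟩
      · exact Or.inr ⟨h', h.symm⟩
  · intro E hE
    rw [Finset.mem_filter, Finset.mem_powerset] at hE
    ext ⟨i, j⟩
    simp only [SimpleGraph.fromRel_adj, Finset.mem_filter, Finset.mem_univ, true_and]
    constructor
    · rintro ⟨h, _, h' | h'⟩
      · exact h'
      · exact absurd (mem_pairs.1 (hE.1 h')).2.2 h.not_gt
    · intro h
      have := (mem_pairs.1 (hE.1 h)).2.2
      exact ⟨this, this.ne, Or.inl h⟩
  · intro G _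
    rfl

lemma boltzmann_eq_pairProd (n : ℕ) (x : Fin n → X) :
    boltzmann v n x = (pairProd (fun i j => mayer v (x i) (x j)) Finset.univ : ℝ) := by
  rw [boltzmann, pairProd, pairs, Complex.ofReal_prod, Finset.univ_product_univ]

/-- This is where the repulsion v ≥ 0 enters; all later domination arguments rest on it. -/
lemma one_add_mayer_mem (x y : X) : 1 + mayer v x y ∈ Set.Icc (0 : ℝ) 1 := by
  rw [mayer, add_sub_cancel]
  split_ifs
  · simp
  · exact ⟨(Real.exp_pos _).le, Real.exp_le_one_iff.2 (by simp)⟩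

variable {v} (hv : ∀ x y, v x y = v y x)
include hv

lemma mayer_comm (x y : X) : mayer v x y = mayer v y x := by rw [mayer, mayer, hv]

lemma connSum_eq_ursell {n k : ℕ} (x : Fin n → X) (e : Fin (k + 1) ↪ Fin n) :
    connSum (fun i j => mayer v (x i) (x j)) (Finset.univ.map e) = ursell v (k + 1) (x ∘ e) := by
  rw [connSum_map (fun i j => mayer_comm hv _ _) e Finset.univ_nonempty, ursell_eq_connSum]
  rfl

lemma pairProd_eq_boltzmann {n k : ℕ} (x : Fin n → X) (e : Fin k ↪ Fin n) :
    ((pairProd (fun i j => mayer v (x i) (x j)) (Finset.univ.map e) : ℝ) : ℂ) =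
      boltzmann v k (x ∘ e) := by
  rw [pairProd_map (fun i j => mayer_comm hv _ _) e, boltzmann_eq_pairProd]
  rfl

end Ursell

/-! ### Graph recursions in coordinates indexed by `Fin n` -/

section Split

variable {X : Type*}

/-- For `U ⊆ Fin n`, the decomposition of `Fin (n + 1)` into `{0} ∪ (U + 1)` and its complement. -/
def splitEquiv {n : ℕ} (U : Finset (Fin n)) :
    Fin (U.card + 1) ⊕ Fin (Uᶜ.card) ≃ Fin (n + 1) :=
  finSumEquivOfFinset (s := insert 0 (U.map (Fin.succEmb n)))
    (by rw [Finset.card_insert_of_notMem (by simp), Finset.card_map])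
    (by
      have hU := U.card_le_univ
      rw [Finset.card_compl, Finset.card_compl, Finset.card_insert_of_notMem (by simp),
        Finset.card_map]
      simp)

/-- The first part of an equivalence from a sum type. -/
def leftEmb {α β γ : Type*} (e : α ⊕ β ≃ γ) : α ↪ γ := Function.Embedding.inl.trans e.toEmbedding

/-- The second part of an equivalence from a sum type. -/
def rightEmb {α β γ : Type*} (e : α ⊕ β ≃ γ) : β ↪ γ := Function.Embedding.inr.trans e.toEmbedding

lemma map_leftEmb_finSumEquivOfFinset {n k l : ℕ} {s : Finset (Fin n)} (hm : s.card = k)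
    (hn : sᶜ.card = l) : Finset.univ.map (leftEmb (finSumEquivOfFinset hm hn)) = s := by
  refine Finset.eq_of_subset_of_card_le (fun i hi => ?_) (by simp [hm])
  obtain ⟨j, _, rfl⟩ := Finset.mem_map.1 hi
  simp [leftEmb]

lemma map_rightEmb_finSumEquivOfFinset {n k l : ℕ} {s : Finset (Fin n)} (hm : s.card = k)
    (hn : sᶜ.card = l) : Finset.univ.map (rightEmb (finSumEquivOfFinset hm hn)) = sᶜ := by
  refine Finset.eq_of_subset_of_card_le (fun i hi => ?_) (by simp [← hn])
  obtain ⟨j, _, rfl⟩ := Finset.mem_map.1 hi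
  exact Finset.orderEmbOfFin_mem sᶜ hn j

lemma map_leftEmb_splitEquiv {n : ℕ} (U : Finset (Fin n)) :
    Finset.univ.map (leftEmb (splitEquiv U)) = insert 0 (U.map (Fin.succEmb n)) :=
  map_leftEmb_finSumEquivOfFinset _ _

lemma map_rightEmb_splitEquiv {n : ℕ} (U : Finset (Fin n)) :
    Finset.univ.map (rightEmb (splitEquiv U)) = Uᶜ.map (Fin.succEmb n) := by
  rw [splitEquiv, map_rightEmb_finSumEquivOfFinset]
  ext i
  refine Fin.cases ?_ (fun i => ?_) i <;> simp

lemma sum_powerset_map {α β M : Type*} [DecidableEq β] [Fintype α] [AddCommMonoid M] (e : α ↪ β)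
    (F : Finset β → M) : ∑ U ∈ (Finset.univ.map e).powerset, F U = ∑ U : Finset α, F (U.map e) := by
  symm
  refine Finset.sum_bij' (fun U _ => U.map e) (fun U _ => Finset.univ.filter fun i => e i ∈ U)
    ?_ ?_ ?_ ?_ ?_
  · intro U _
    simp
  · simp
  · intro U _
    ext i
    simp
  · intro U hU
    rw [Finset.mem_powerset] at hU
    ext j
    simp only [Finset.mem_map, Finset.mem_filter, Finset.mem_univ, true_and]
    constructor
    · rintro ⟨i, h, rfl⟩
      exact h
    · intro h
      obtain ⟨i, _, rfl⟩ := Finset.mem_map.1 (hU h)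
      exact ⟨i, h, rfl⟩
  · simp

lemma univ_map_sdiff {α β : Type*} [DecidableEq α] [DecidableEq β] [Fintype α] (e : α ↪ β)
    (U : Finset α) : Finset.univ.map e \ U.map e = Uᶜ.map e := by
  rw [← Finset.map_sdiff, Finset.compl_eq_univ_sdiff]

lemma prod_comp_split {α β γ M : Type*} [Fintype α] [Fintype β] [Fintype γ] [CommMonoid M]
    (e : α ⊕ β ≃ γ) (u : γ → M) :
    ∏ i, u i = (∏ i, u (leftEmb e i)) * ∏ i, u (rightEmb e i) := by
  rw [← e.prod_comp, Fintype.prod_sum_type]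
  rfl

variable {v : X → X → ℝ≥0∞} (hv : ∀ x y, v x y = v y x)
include hv

/-- Decomposition by the component of vertex 0, which consists of 0 and the shifted set `U`. After
integration it becomes the recursion behind the exponential formula. -/
lemma boltzmann_succ {n : ℕ} (x : Fin (n + 1) → X) :
    boltzmann v (n + 1) x = ∑ U : Finset (Fin n),
      (ursell v (U.card + 1) (x ∘ leftEmb (splitEquiv U)) : ℂ) *
        boltzmann v Uᶜ.card (x ∘ rightEmb (splitEquiv U)) := by
  have h0 : (0 : Fin (n + 1)) ∉ Finset.univ.map (Fin.succEmb n) := by simp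
  have hu : (Finset.univ : Finset (Fin (n + 1))) = insert 0 (Finset.univ.map (Fin.succEmb n)) := by
    ext i
    refine Fin.cases ?_ (fun i => ?_) i <;> simp
  rw [boltzmann_eq_pairProd, hu, pairProd_insert_eq_sum _ h0, sum_powerset_map, Complex.ofReal_sum]
  refine Finset.sum_congr rfl fun U _ => ?_
  rw [Complex.ofReal_mul, ← map_leftEmb_splitEquiv, connSum_eq_ursell hv, univ_map_sdiff,
    ← map_rightEmb_splitEquiv, pairProd_eq_boltzmann hv]

/-- `connSum_insert_insert` with root `r = 0`, located at `y`, and marked vertex `a = 1`. The factor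
∏ (1 + f) - 1 says that the root is joined to the component of `a` by at least one edge. -/
lemma ursell_cons_succ {n : ℕ} (y : X) (x : Fin (n + 1) → X) :
    ursell v (n + 2) (Fin.cons y x : Fin (n + 2) → X) = ∑ U : Finset (Fin n),
      (((∏ i, (1 + mayer v y (x (leftEmb (splitEquiv U) i)))) - 1) *
        ursell v (U.card + 1) (x ∘ leftEmb (splitEquiv U))) *
        ursell v (Uᶜ.card + 1)
          (Fin.cons y (x ∘ rightEmb (splitEquiv U)) : Fin (Uᶜ.card + 1) → X) := by
  set w : Fin (n + 2) → X := Fin.cons y x with hw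
  set A : Finset (Fin (n + 2)) :=
    Finset.univ.map ((Fin.succEmb n).trans (Fin.succEmb (n + 1))) with hA
  have hu : (Finset.univ : Finset (Fin (n + 2))) = insert 0 (insert (Fin.succ 0) A) := by
    ext i
    refine Fin.cases ?_ (fun i => ?_) i
    · simp
    · refine Fin.cases ?_ (fun i => ?_) i <;> simp [A]
  have hr : (0 : Fin (n + 2)) ≠ Fin.succ 0 := (Fin.succ_ne_zero _).symm
  rw [ursell_eq_connSum, hu, connSum_insert_insert (fun i j => mayer_comm hv _ _) hr
    (by simp [A]) ?_, hA, sum_powerset_map]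
  swap
  · intro h
    obtain ⟨i, _, hi⟩ := Finset.mem_map.1 h
    exact absurd (Fin.succ_injective _ hi) (Fin.succ_ne_zero _)
  refine Finset.sum_congr rfl fun U _ => ?_
  have h1 : insert (Fin.succ 0) (U.map ((Fin.succEmb n).trans (Fin.succEmb (n + 1)))) =
      Finset.univ.map ((leftEmb (splitEquiv U)).trans (Fin.succEmb (n + 1))) := by
    rw [← Finset.map_map, ← Finset.map_map, map_leftEmb_splitEquiv, Finset.map_insert]
    rfl
  -- The root is kept in position 0, so that the points along `e` again form a tuple `Fin.cons y _`.
  let e : Fin (Uᶜ.card + 1) ↪ Fin (n + 2) :=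
    ⟨Fin.cons 0 fun i => (rightEmb (splitEquiv U) i).succ, by
      rw [Fin.cons_injective_iff]
      refine ⟨by simp, fun i j h => ?_⟩
      exact (rightEmb (splitEquiv U)).injective (Fin.succ_injective _ h)⟩
  have h2 : insert 0 (Finset.univ.map ((Fin.succEmb n).trans (Fin.succEmb (n + 1))) \
      U.map ((Fin.succEmb n).trans (Fin.succEmb (n + 1)))) = Finset.univ.map e := by
    rw [univ_map_sdiff, ← Finset.map_map, ← map_rightEmb_splitEquiv]
    ext i
    simp only [Finset.mem_insert, Finset.mem_map, Finset.mem_univ, true_and]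
    constructor
    · rintro (rfl | ⟨_, ⟨i, rfl⟩, rfl⟩)
      · exact ⟨0, rfl⟩
      · exact ⟨i.succ, rfl⟩
    · rintro ⟨i, rfl⟩
      refine Fin.cases (Or.inl rfl) (fun i => Or.inr ⟨_, ⟨i, rfl⟩, rfl⟩) i
  have h3 : w ∘ e = (Fin.cons y (x ∘ rightEmb (splitEquiv U)) : Fin (Uᶜ.card + 1) → X) := by
    funext i
    refine Fin.cases ?_ (fun i => ?_) i <;> simp [w, e]
  rw [h1, h2, connSum_eq_ursell hv, connSum_eq_ursell hv, h3, Finset.prod_map]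
  rfl

end Split

/-! ### Factorization of integrals over a splitting of the coordinates -/

section SplitMeasure

variable {X : Type*} [MeasurableSpace X] (ρ : Measure X) [SigmaFinite ρ]

lemma measurePreserving_split {α β γ : Type*} [Fintype α] [Fintype β] [Fintype γ]
    (e : α ⊕ β ≃ γ) :
    ∃ Φ : (γ → X) ≃ᵐ (α → X) × (β → X), (∀ x, Φ x = (x ∘ leftEmb e, x ∘ rightEmb e)) ∧
      MeasurePreserving Φ (Measure.pi fun _ => ρ)
        ((Measure.pi fun _ => ρ).prod (Measure.pi fun _ => ρ)) := by
  refine ⟨(MeasurableEquiv.piCongrLeft (fun _ => X) e).symm.trans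
    (MeasurableEquiv.sumPiEquivProdPi fun _ => X), fun x => ?_, ?_⟩
  · rfl
  · exact (measurePreserving_sumPiEquivProdPi (X := fun _ => X) (fun _ => ρ)).comp
      (measurePreserving_piCongrLeft (fun _ => ρ) e).symm

variable {ρ}

lemma lintegral_split_mul {α β γ : Type*} [Fintype α] [Fintype β] [Fintype γ]
    (e : α ⊕ β ≃ γ) {F : (α → X) → ℝ≥0∞} {G : (β → X) → ℝ≥0∞} (hF : Measurable F)
    (hG : Measurable G) :
    ∫⁻ x, F (x ∘ leftEmb e) * G (x ∘ rightEmb e) ∂(Measure.pi fun _ => ρ) =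
      (∫⁻ x, F x ∂(Measure.pi fun _ => ρ)) * ∫⁻ x, G x ∂(Measure.pi fun _ => ρ) := by
  obtain ⟨Φ, hfun, hmp⟩ := measurePreserving_split ρ e
  rw [← lintegral_prod_mul hF.aemeasurable hG.aemeasurable, ← hmp.lintegral_comp_emb
    Φ.measurableEmbedding]
  simp only [hfun]

lemma integral_split_mul {α β γ : Type*} [Fintype α] [Fintype β] [Fintype γ]
    (e : α ⊕ β ≃ γ) (F : (α → X) → ℂ) (G : (β → X) → ℂ) :
    ∫ x, F (x ∘ leftEmb e) * G (x ∘ rightEmb e) ∂(Measure.pi fun _ => ρ) =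
      (∫ x, F x ∂(Measure.pi fun _ => ρ)) * ∫ x, G x ∂(Measure.pi fun _ => ρ) := by
  obtain ⟨Φ, hfun, hmp⟩ := measurePreserving_split ρ e
  rw [← integral_prod_mul, ← hmp.integral_comp Φ.measurableEmbedding]
  simp only [hfun]

lemma integrable_split_mul {α β γ : Type*} [Fintype α] [Fintype β] [Fintype γ]
    (e : α ⊕ β ≃ γ) {F : (α → X) → ℂ} {G : (β → X) → ℂ}
    (hF : Integrable F (Measure.pi fun _ => ρ)) (hG : Integrable G (Measure.pi fun _ => ρ)) :
    Integrable (fun x => F (x ∘ leftEmb e) * G (x ∘ rightEmb e)) (Measure.pi fun _ => ρ) := by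
  obtain ⟨Φ, hfun, hmp⟩ := measurePreserving_split ρ e
  have := (hmp.integrable_comp_emb Φ.measurableEmbedding).2 (hF.mul_prod hG)
  simpa only [Function.comp_def, hfun] using! this

lemma lintegral_pi_succ {n : ℕ} {F : (Fin (n + 1) → X) → ℝ≥0∞} (hF : Measurable F) :
    ∫⁻ x, F x ∂(Measure.pi fun _ => ρ) =
      ∫⁻ y, ∫⁻ x, F (Fin.cons y x : Fin (n + 1) → X) ∂(Measure.pi fun _ => ρ) ∂ρ := by
  have hmp := (measurePreserving_piFinSuccAbove (fun _ : Fin (n + 1) => ρ) 0).symm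
  rw [← hmp.lintegral_comp_emb (MeasurableEquiv.measurableEmbedding _), lintegral_prod]
  · simp [MeasurableEquiv.piFinSuccAbove, Fin.insertNthEquiv]
  · exact (hF.comp (MeasurableEquiv.measurable _)).aemeasurable

end SplitMeasure

/-! ### Sums over subsets grouped by cardinality -/

section Species

lemma sum_finset_fin_card {M : Type*} [AddCommMonoid M] (n : ℕ) (h : ℕ → ℕ → M) :
    ∑ U : Finset (Fin n), h U.card Uᶜ.card =
      ∑ k ∈ Finset.range (n + 1), n.choose k • h k (n - k) := by
  rw [← Finset.powerset_univ]
  have := Finset.sum_powerset_apply_card (fun k => h k (n - k)) (x := (Finset.univ : Finset (Fin n)))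
  rw [Finset.card_fin] at this
  rw [← this]
  exact Finset.sum_congr rfl fun U _ => by rw [Finset.card_compl, Fintype.card_fin]

end Species

/-! ### Differential equations and inequalities for generating functions -/

section Series

/-- A discrete Grönwall inequality for coefficients of power series. -/
lemma sum_le_exp_of_recursion_real (p s : ℕ → ℝ) (N : ℕ) (hp : ∀ n, 0 ≤ p n)
    (hs : ∀ n, 0 ≤ s n) (h0 : p 0 ≤ 1)
    (h : ∀ n < N, (n + 1) * p (n + 1) ≤ ∑ k ∈ Finset.range (n + 1), (k + 1) * s k * p (n - k)) :
    ∑ n ∈ Finset.range (N + 1), p n ≤ Real.exp (∑ k ∈ Finset.range N, s k) := by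
  -- `s k` is the coefficient of t^(k+1) in `S`, so the recursion compares the coefficients of Q'
  -- with those of S' Q.
  set Q : ℝ → ℝ := fun t => ∑ n ∈ Finset.range (N + 1), p n * t ^ n with hQ
  set S : ℝ → ℝ := fun t => ∑ k ∈ Finset.range N, s k * t ^ (k + 1) with hS
  set Q' : ℝ → ℝ := fun t => ∑ n ∈ Finset.range N, ((n + 1) * p (n + 1)) * t ^ n with hQ'
  set S' : ℝ → ℝ := fun t => ∑ k ∈ Finset.range N, ((k + 1) * s k) * t ^ k with hS'
  have hdQ : ∀ t, HasDerivAt Q (Q' t) t := by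
    intro t
    have h1 : HasDerivAt Q (∑ n ∈ Finset.range (N + 1), p n * (n * t ^ (n - 1))) t :=
      HasDerivAt.fun_sum fun n _ => (hasDerivAt_pow n t).const_mul _
    convert h1 using 1
    rw [Finset.sum_range_succ']
    simp only [hQ', Nat.cast_add, Nat.cast_one, add_tsub_cancel_right, Nat.cast_zero, zero_mul,
      mul_zero, add_zero]
    exact Finset.sum_congr rfl fun n _ => by ring
  have hdS : ∀ t, HasDerivAt S (S' t) t := by
    intro t
    have h1 : HasDerivAt S (∑ n ∈ Finset.range N, s n * ((n + 1 : ℕ) * t ^ (n + 1 - 1))) t :=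
      HasDerivAt.fun_sum fun n _ => (hasDerivAt_pow (n + 1) t).const_mul _
    convert h1 using 1
    simp only [hS', Nat.cast_add, Nat.cast_one, add_tsub_cancel_right]
    exact Finset.sum_congr rfl fun n _ => by ring
  have hle : ∀ t, 0 ≤ t → Q' t ≤ S' t * Q t := by
    intro t ht
    calc Q' t ≤ ∑ n ∈ Finset.range N, ∑ k ∈ Finset.range (n + 1),
          ((k + 1) * s k * t ^ k) * (p (n - k) * t ^ (n - k)) := by
          refine Finset.sum_le_sum fun n hn => ?_
          refine (mul_le_mul_of_nonneg_right (h n (Finset.mem_range.1 hn))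
            (pow_nonneg ht n)).trans_eq ?_
          rw [Finset.sum_mul]
          refine Finset.sum_congr rfl fun k hk => ?_
          rw [← Nat.add_sub_of_le (Nat.lt_succ_iff.1 (Finset.mem_range.1 hk)), pow_add]
          simp only [add_tsub_cancel_left]
          ring
      _ ≤ S' t * Q t := by
          rw [hS', hQ]
          simp only [Finset.sum_mul_sum, ← Finset.sum_product', Finset.sum_sigma']
          -- The left side runs over pairs `(k, n - k)` with `k ≤ n < N`, a part of the index set of
          -- the product S' Q; the remaining terms of the product are nonnegative.
          have hinj : Set.InjOn (fun x : (_ : ℕ) × ℕ => (x.2, x.1 - x.2))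
              ((Finset.range N).sigma fun n => Finset.range (n + 1)) := by
            rintro ⟨n, k⟩ hx ⟨m, l⟩ hy hxy
            simp only [Finset.coe_sigma, Set.mem_sigma_iff, Finset.mem_coe, Finset.mem_range]
              at hx hy
            simp only [Prod.mk.injEq] at hxy
            obtain ⟨rfl, h2⟩ := hxy
            obtain rfl : n = m := by omega
            rfl
          rw [← Finset.sum_image (f := fun y : ℕ × ℕ =>
            (((y.1 : ℝ) + 1) * s y.1 * t ^ y.1) * (p y.2 * t ^ y.2)) hinj]
          refine Finset.sum_le_sum_of_subset_of_nonneg (fun y hy => ?_) fun y _ _ => ?_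
          · obtain ⟨⟨n, k⟩, hx, rfl⟩ := Finset.mem_image.1 hy
            simp only [Finset.mem_sigma, Finset.mem_range, Finset.mem_product] at hx ⊢
            omega
          · have := hs y.1
            have := hp y.2
            positivity
  -- From Q' ≤ S' Q the function Q exp(-S) decreases on [0, 1]; comparing its values at 0 and 1
  -- gives the bound.
  have hanti : AntitoneOn (fun t => Q t * Real.exp (-S t)) (Set.Icc 0 1) := by
    have hd : ∀ t, HasDerivAt (fun t => Q t * Real.exp (-S t))
        (Q' t * Real.exp (-S t) + Q t * (Real.exp (-S t) * -S' t)) t := fun t =>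
      (hdQ t).mul (hdS t).neg.exp
    refine antitoneOn_of_deriv_nonpos (convex_Icc 0 1)
      (fun t _ => (hd t).continuousAt.continuousWithinAt)
      (fun t _ => (hd t).differentiableAt.differentiableWithinAt) fun t ht => ?_
    rw [interior_Icc] at ht
    rw [(hd t).deriv]
    have := hle t ht.1.le
    nlinarith [Real.exp_pos (-S t)]
  have h01 := hanti (Set.left_mem_Icc.2 zero_le_one) (Set.right_mem_Icc.2 zero_le_one) zero_le_one
  have hQ1 : Q 1 = ∑ n ∈ Finset.range (N + 1), p n := by simp [hQ]
  have hS1 : S 1 = ∑ k ∈ Finset.range N, s k := by simp [hS]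
  have hQ0 : Q 0 = p 0 := by simp [hQ, Finset.sum_range_succ']
  have hS0 : S 0 = 0 := by simp [hS]
  simp only [hQ1, hS1, hQ0, hS0, neg_zero, Real.exp_zero, mul_one] at h01
  rw [Real.exp_neg, ← div_eq_mul_inv, div_le_iff₀ (Real.exp_pos _)] at h01
  nlinarith [Real.exp_pos (∑ k ∈ Finset.range N, s k)]

lemma sum_le_exp_of_recursion (p s : ℕ → ℝ≥0∞) (N : ℕ) (c : ℝ) (h0 : p 0 ≤ 1)
    (h : ∀ n < N, (n + 1) * p (n + 1) ≤ ∑ k ∈ Finset.range (n + 1), (k + 1) * s k * p (n - k))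
    (hs : ∑ k ∈ Finset.range N, s k ≤ ENNReal.ofReal c) (hc : 0 ≤ c) :
    ∑ n ∈ Finset.range (N + 1), p n ≤ ENNReal.ofReal (Real.exp c) := by
  have hsfin : ∀ k < N, s k ≠ ∞ := fun k hk =>
    ((Finset.single_le_sum (fun i _ => zero_le) (Finset.mem_range.2 hk)).trans hs).trans_lt
      ENNReal.ofReal_lt_top |>.ne
  -- Finiteness has to precede the passage to real numbers. It is inherited along the recursion,
  -- whose right side contains only `p` of smaller index.
  have hpfin : ∀ n ≤ N, p n ≠ ∞ := by
    intro n
    induction n using Nat.strong_induction_on with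
    | _ n ih =>
      rcases n with _ | n
      · exact fun _ => (h0.trans_lt ENNReal.one_lt_top).ne
      · intro hn hp
        have h1 := h n hn
        rw [hp, ENNReal.mul_top (by simp), top_le_iff, ENNReal.sum_eq_top] at h1
        obtain ⟨k, hk, hk'⟩ := h1
        rw [Finset.mem_range] at hk
        exact ENNReal.mul_ne_top (ENNReal.mul_ne_top (by finiteness) (hsfin k (by omega)))
          (ih (n - k) (by omega) (by omega)) hk'
  have hp' : ∀ n ≤ N, ENNReal.ofReal (p n).toReal = p n := fun n hn =>
    ENNReal.ofReal_toReal (hpfin n hn)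
  have hs' : ∀ n < N, ENNReal.ofReal (s n).toReal = s n := fun n hn =>
    ENNReal.ofReal_toReal (hsfin n hn)
  have main := sum_le_exp_of_recursion_real (fun n => (p n).toReal) (fun n => (s n).toReal) N
    (fun n => ENNReal.toReal_nonneg) (fun n => ENNReal.toReal_nonneg)
    (ENNReal.toReal_le_of_le_ofReal zero_le_one (by simpa using h0)) (fun n hn => by
      have h1 := ENNReal.toReal_mono (ENNReal.sum_ne_top.2 fun k hk => ?_) (h n hn)
      · rw [ENNReal.toReal_sum] at h1
        · simpa [ENNReal.toReal_add] using h1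
        · intro k hk
          rw [Finset.mem_range] at hk
          exact ENNReal.mul_ne_top (ENNReal.mul_ne_top (by finiteness) (hsfin k (by omega)))
            (hpfin (n - k) (by omega))
      · rw [Finset.mem_range] at hk
        exact ENNReal.mul_ne_top (ENNReal.mul_ne_top (by finiteness) (hsfin k (by omega)))
          (hpfin (n - k) (by omega)))
  have hsum : ∑ n ∈ Finset.range (N + 1), p n =
      ENNReal.ofReal (∑ n ∈ Finset.range (N + 1), (p n).toReal) := by
    rw [ENNReal.ofReal_sum_of_nonneg fun _ _ => ENNReal.toReal_nonneg]
    exact Finset.sum_congr rfl fun n hn =>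
      (hp' n (Nat.lt_succ_iff.1 (Finset.mem_range.1 hn))).symm
  have hsum' : ∑ n ∈ Finset.range N, (s n).toReal ≤ c := by
    rw [← ENNReal.ofReal_le_ofReal_iff hc,
      ENNReal.ofReal_sum_of_nonneg fun _ _ => ENNReal.toReal_nonneg]
    exact (Finset.sum_congr rfl fun n hn => hs' n (Finset.mem_range.1 hn)).trans_le hs
  rw [hsum]
  exact ENNReal.ofReal_le_ofReal (main.trans (Real.exp_le_exp.2 hsum'))

/-- The exponential formula for coefficients of power series, evaluated at `1`. -/
lemma tsum_eq_exp_of_recursion (b a : ℕ → ℂ) (hb : Summable fun n : ℕ => ‖(n : ℂ) * b n‖)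
    (ha : Summable fun k : ℕ => ‖((k : ℂ) + 1) * a k‖) (h0 : b 0 = 1)
    (h : ∀ n : ℕ, ((n : ℂ) + 1) * b (n + 1) =
      ∑ k ∈ Finset.range (n + 1), (((k : ℂ) + 1) * a k) * b (n - k)) :
    ∑' n, b n = Complex.exp (∑' k, a k) := by
  have hb' : Summable fun n => ‖b n‖ := by
    rw [← summable_nat_add_iff 1] at hb ⊢
    refine hb.of_nonneg_of_le (fun _ => norm_nonneg _) fun n => ?_
    rw [norm_mul]
    refine le_mul_of_one_le_left (norm_nonneg _) ?_
    rw [Complex.norm_natCast]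
    exact_mod_cast Nat.succ_pos n
  have ha' : Summable fun n => ‖a n‖ := by
    refine ha.of_nonneg_of_le (fun _ => norm_nonneg _) fun n => ?_
    rw [norm_mul]
    refine le_mul_of_one_le_left (norm_nonneg _) ?_
    rw [← Nat.cast_succ, Complex.norm_natCast]
    exact_mod_cast Nat.succ_pos n
  have hpow : ∀ (z : ℂ) (t : ℝ) (n : ℕ), |t| ≤ 1 → ‖z * (t : ℂ) ^ n‖ ≤ ‖z‖ := by
    intro z t n ht
    rw [norm_mul, norm_pow, Complex.norm_real]
    exact mul_le_of_le_one_right (norm_nonneg _) (pow_le_one₀ (norm_nonneg _) ht)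
  set Q : ℝ → ℂ := fun t => ∑' n, b n * (t : ℂ) ^ n with hQ
  set S : ℝ → ℂ := fun t => ∑' n, a n * (t : ℂ) ^ (n + 1) with hS
  set S' : ℝ → ℂ := fun t => ∑' n : ℕ, (((n : ℂ) + 1) * a n) * (t : ℂ) ^ n with hS'
  have hIoo : ∀ t ∈ Set.Ioo (-1 : ℝ) 1, |t| ≤ 1 := fun t ht => abs_le.2 ⟨ht.1.le, ht.2.le⟩
  have h0mem : (0 : ℝ) ∈ Set.Ioo (-1 : ℝ) 1 := by norm_num
  have hdS : ∀ t ∈ Set.Ioo (-1 : ℝ) 1, HasDerivAt S (S' t) t := by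
    intro t ht
    refine hasDerivAt_tsum_of_isPreconnected
      (g' := fun (n : ℕ) (t : ℝ) => (((n : ℂ) + 1) * a n) * (t : ℂ) ^ n) ha isOpen_Ioo
      isPreconnected_Ioo (fun n y _ => ?_) (fun n y hy => hpow _ _ _ (hIoo y hy)) h0mem ?_ ht
    · have := ((hasDerivAt_pow (n + 1) (y : ℂ)).comp_ofReal).const_mul (a n)
      refine this.congr_deriv ?_
      show a n * (((n + 1 : ℕ) : ℂ) * (y : ℂ) ^ n) = (((n : ℂ) + 1) * a n) * (y : ℂ) ^ n
      push_cast
      ring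
    · exact Summable.of_norm_bounded ha' fun n => hpow _ _ _ (by simp)
  -- The summability of n b_n dominates the differentiated series for |t| < 1, and the recursion
  -- identifies it with the Cauchy product S' Q.
  have hdQ : ∀ t ∈ Set.Ioo (-1 : ℝ) 1, HasDerivAt Q (S' t * Q t) t := by
    intro t ht
    have h1 : HasDerivAt Q (∑' n : ℕ, ((n : ℂ) * b n) * (t : ℂ) ^ (n - 1)) t := by
      refine hasDerivAt_tsum_of_isPreconnected
        (g' := fun (n : ℕ) (t : ℝ) => ((n : ℂ) * b n) * (t : ℂ) ^ (n - 1)) hb isOpen_Ioo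
        isPreconnected_Ioo (fun n y _ => ?_) (fun n y hy => hpow _ _ _ (hIoo y hy)) h0mem ?_ ht
      · have := ((hasDerivAt_pow n (y : ℂ)).comp_ofReal).const_mul (b n)
        refine this.congr_deriv ?_
        show b n * ((n : ℂ) * (y : ℂ) ^ (n - 1)) = ((n : ℂ) * b n) * (y : ℂ) ^ (n - 1)
        ring
      · exact Summable.of_norm_bounded hb' fun n => hpow _ _ _ (by simp)
    convert h1 using 1
    have hsum : Summable fun n : ℕ => ((n : ℂ) * b n) * (t : ℂ) ^ (n - 1) :=
      Summable.of_norm_bounded hb fun n => hpow _ _ _ (hIoo t ht)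
    rw [hsum.tsum_eq_zero_add, hS', hQ]
    dsimp only
    rw [tsum_mul_tsum_eq_tsum_sum_range_of_summable_norm
      (ha.of_nonneg_of_le (fun _ => norm_nonneg _) fun n => hpow _ _ _ (hIoo t ht))
      (hb'.of_nonneg_of_le (fun _ => norm_nonneg _) fun n => hpow _ _ _ (hIoo t ht))]
    simp only [Nat.cast_zero, zero_mul, zero_add, Nat.cast_add, Nat.cast_one,
      add_tsub_cancel_right]
    refine tsum_congr fun n => ?_
    rw [h n, Finset.sum_mul]
    refine Finset.sum_congr rfl fun k hk => ?_
    have hnk : (t : ℂ) ^ n = (t : ℂ) ^ k * (t : ℂ) ^ (n - k) := by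
      rw [← pow_add, Nat.add_sub_of_le (Nat.lt_succ_iff.1 (Finset.mem_range.1 hk))]
    rw [hnk]
    ring
  -- The derivative is known only inside the interval; continuity up to t = 1 carries the constancy
  -- of Q exp(-S) to the endpoint.
  have hcQ : ContinuousOn Q (Set.Icc 0 1) :=
    continuousOn_tsum (fun n => by fun_prop) hb' fun n t ht =>
      hpow _ _ _ (abs_le.2 ⟨by linarith [ht.1], ht.2⟩)
  have hcS : ContinuousOn S (Set.Icc 0 1) :=
    continuousOn_tsum (fun n => by fun_prop) ha' fun n t ht =>
      hpow _ _ _ (abs_le.2 ⟨by linarith [ht.1], ht.2⟩)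
  have hconst := constant_of_has_deriv_right_zero (f := fun t => Q t * Complex.exp (-S t))
    (a := 0) (b := 1) (hcQ.mul hcS.neg.cexp) (fun t ht => by
      have ht' : t ∈ Set.Ioo (-1 : ℝ) 1 := ⟨by linarith [ht.1], ht.2⟩
      have := ((hdQ t ht').mul (hdS t ht').neg.cexp).hasDerivWithinAt (s := Set.Ici t)
      refine this.congr_deriv ?_
      show S' t * Q t * Complex.exp (-S t) + Q t * (Complex.exp (-S t) * -S' t) = 0
      ring) 1 (by simp)
  have hQ0 : Q 0 = 1 := by
    rw [hQ]
    dsimp only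
    rw [tsum_eq_single 0 fun n hn => by simp [hn], h0]
    simp
  have hS0 : S 0 = 0 := by simp [hS]
  simp only [hQ0, hS0, neg_zero, Complex.exp_zero, mul_one] at hconst
  rw [Complex.exp_neg, ← div_eq_mul_inv, div_eq_one_iff_eq (Complex.exp_ne_zero _)] at hconst
  simpa [hQ, hS] using hconst

end Series

/-! ### Distribution of factorials over binomial sums -/

section Factorial

lemma inv_factorial_mul_choose {n k : ℕ} (hk : k ≤ n) (a b : ℝ≥0∞) :
    ((n ! : ℕ) : ℝ≥0∞)⁻¹ * (n.choose k * (a * b)) =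
      (((k ! : ℕ) : ℝ≥0∞)⁻¹ * a) * ((((n - k)! : ℕ) : ℝ≥0∞)⁻¹ * b) := by
  have h0 : ∀ m : ℕ, ((m ! : ℕ) : ℝ≥0∞) ≠ 0 := fun m => by simp [m.factorial_ne_zero]
  have ht : ∀ m : ℕ, ((m ! : ℕ) : ℝ≥0∞) ≠ ∞ := fun m => ENNReal.natCast_ne_top _
  have hC : ((n.choose k : ℕ) : ℝ≥0∞) ≠ 0 := by simp [(Nat.choose_pos hk).ne']
  rw [← Nat.choose_mul_factorial_mul_factorial hk, Nat.cast_mul, Nat.cast_mul,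
    ENNReal.mul_inv (Or.inr (ht _)) (Or.inr (h0 _)), ENNReal.mul_inv (Or.inr (ht _)) (Or.inr (h0 _))]
  calc _ = (((n.choose k : ℕ) : ℝ≥0∞)⁻¹ * ((n.choose k : ℕ) : ℝ≥0∞)) *
        ((((k ! : ℕ) : ℝ≥0∞)⁻¹ * a) * ((((n - k)! : ℕ) : ℝ≥0∞)⁻¹ * b)) := by ring
    _ = _ := by rw [ENNReal.inv_mul_cancel hC (ENNReal.natCast_ne_top _), one_mul]

lemma inv_factorial_mul_choose_complex {n k : ℕ} (hk : k ≤ n) (a b : ℂ) :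
    ((n ! : ℕ) : ℂ)⁻¹ * (n.choose k * (a * b)) =
      (((k ! : ℕ) : ℂ)⁻¹ * a) * ((((n - k)! : ℕ) : ℂ)⁻¹ * b) := by
  have h0 : ∀ m : ℕ, ((m ! : ℕ) : ℂ) ≠ 0 := fun m => by simp [m.factorial_ne_zero]
  have hC : ((n.choose k : ℕ) : ℂ) ≠ 0 := by simp [(Nat.choose_pos hk).ne']
  rw [← Nat.choose_mul_factorial_mul_factorial hk, Nat.cast_mul, Nat.cast_mul]
  have := h0 k
  have := h0 (n - k)
  field_simp

end Factorial

/-! ### Measurability of the interaction functions -/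

section Measurability

variable {X : Type*} [MeasurableSpace X] {v : X → X → ℝ≥0∞}

lemma measurable_mayer (hv : Measurable (Function.uncurry v)) :
    Measurable (Function.uncurry (mayer v)) := by
  have : Function.uncurry (mayer v) = fun p => (if Function.uncurry v p = ∞ then 0 else
      Real.exp (-(Function.uncurry v p).toReal)) - 1 := rfl
  rw [this]
  refine (Measurable.ite (hv (measurableSet_singleton ∞)) measurable_const ?_).sub_const 1
  exact hv.ennreal_toReal.neg.exp

lemma measurable_mayer_comp {Ω : Type*} [MeasurableSpace Ω] (hv : Measurable (Function.uncurry v))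
    {g h : Ω → X} (hg : Measurable g) (hh : Measurable h) :
    Measurable fun ω => mayer v (g ω) (h ω) :=
  (measurable_mayer hv).comp (hg.prodMk hh)

lemma measurable_ursell (hv : Measurable (Function.uncurry v)) (n : ℕ) :
    Measurable (ursell v n) := by
  classical
  exact Finset.measurable_sum _ fun _ _ => Finset.measurable_prod _ fun _ _ =>
    measurable_mayer_comp hv (measurable_pi_apply _) (measurable_pi_apply _)

lemma measurable_boltzmann (hv : Measurable (Function.uncurry v)) (n : ℕ) :
    Measurable (boltzmann v n) :=
  Finset.measurable_prod _ fun _ _ => Complex.measurable_ofReal.comp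
    (measurable_const.add (measurable_mayer_comp hv (measurable_pi_apply _)
      (measurable_pi_apply _)))

lemma measurable_fin_cons {n : ℕ} :
    Measurable fun p : X × (Fin n → X) => (Fin.cons p.1 p.2 : Fin (n + 1) → X) := by
  refine measurable_pi_lambda _ fun i => ?_
  refine Fin.cases ?_ (fun i => ?_) i
  · simpa using measurable_fst
  · simpa [Function.comp_def] using (measurable_pi_apply i).comp (measurable_snd (α := X))

lemma measurable_comp_index {α β : Type*} (e : α → β) : Measurable fun x : β → X => x ∘ e :=
  measurable_pi_lambda _ fun _ => measurable_pi_apply _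

end Measurability

/-! ### Convergence bounds for rooted clusters -/

section Bound

variable {X : Type*} {v : X → X → ℝ≥0∞}

lemma ursell_one (x : Fin 1 → X) : ursell v 1 x = 1 := by
  have h : (Finset.univ : Finset (Fin 1)) = insert 0 ∅ := rfl
  rw [ursell_eq_connSum, h, connSum_insert _ (Finset.notMem_empty _)]
  simp [pairProd, pairs, Finset.ssubsets, Finset.filter_singleton]

lemma ursell_comp_perm (hv : ∀ x y, v x y = v y x) {n : ℕ} (x : Fin (n + 1) → X)
    (e : Equiv.Perm (Fin (n + 1))) : ursell v (n + 1) (x ∘ e) = ursell v (n + 1) x := by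
  have := connSum_eq_ursell hv x e.toEmbedding
  rw [Finset.map_univ_equiv, ← ursell_eq_connSum] at this
  exact this.symm

/-- Telescoping: changing one factor from 1 to 1 + g costs at most |g|, since the other factors lie
in [0, 1]. -/
lemma abs_prod_sub_one_le {α : Type*} (s : Finset α) (g : α → ℝ)
    (hg : ∀ i, 1 + g i ∈ Set.Icc (0 : ℝ) 1) : |(∏ i ∈ s, (1 + g i)) - 1| ≤ ∑ i ∈ s, |g i| := by
  classical
  induction s using Finset.induction_on with
  | empty => simp
  | insert a s ha ih =>
    rw [Finset.prod_insert ha, Finset.sum_insert ha]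
    have h : (1 + g a) * ∏ i ∈ s, (1 + g i) - 1 =
        g a * ∏ i ∈ s, (1 + g i) + ((∏ i ∈ s, (1 + g i)) - 1) := by ring
    rw [h]
    refine (abs_add_le _ _).trans (add_le_add ?_ ih)
    rw [abs_mul, abs_of_nonneg (Finset.prod_nonneg fun i _ => (hg i).1)]
    exact mul_le_of_le_one_right (abs_nonneg _)
      (Finset.prod_le_one (fun i _ => (hg i).1) fun i _ => (hg i).2)

lemma enorm_zeta_le (y : X) {n : ℕ} (x : Fin n → X) :
    ‖(∏ i, (1 + mayer v y (x i))) - 1‖ₑ ≤ ∑ i, ‖mayer v y (x i)‖ₑ := by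
  have := abs_prod_sub_one_le Finset.univ (fun i => mayer v y (x i))
    fun i => one_add_mayer_mem v y (x i)
  simp only [Real.enorm_eq_ofReal_abs]
  rw [← ENNReal.ofReal_sum_of_nonneg fun _ _ => abs_nonneg _]
  exact ENNReal.ofReal_le_ofReal this

variable [MeasurableSpace X]

variable (v) in
/-- The integral of `|φᵀ(y, x₁, …, xₙ)|` over `x` with weight `w`. -/
def rootedIntegral (ρ : Measure X) (w : X → ℝ≥0∞) (n : ℕ) (y : X) : ℝ≥0∞ :=
  ∫⁻ x, ‖ursell v (n + 1) (Fin.cons y x : Fin (n + 1) → X)‖ₑ * ∏ i, w (x i)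
    ∂(Measure.pi fun _ : Fin n => ρ)

variable {ρ : Measure X} [SigmaFinite ρ] {w : X → ℝ≥0∞}

lemma measurable_rootedIntegral (hv : Measurable (Function.uncurry v)) (hw : Measurable w) (n : ℕ) :
    Measurable (rootedIntegral v ρ w n) := by
  refine Measurable.lintegral_prod_right' (f := fun p : X × (Fin n → X) =>
    ‖ursell v (n + 1) (Fin.cons p.1 p.2 : Fin (n + 1) → X)‖ₑ * ∏ i, w (p.2 i)) ?_
  refine ((measurable_ursell hv _).comp measurable_fin_cons).enorm.mul ?_
  exact Finset.measurable_prod _ fun i _ => hw.comp ((measurable_pi_apply i).comp measurable_snd)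

lemma lintegral_comp_perm {n : ℕ} (e : Equiv.Perm (Fin n)) (F : (Fin n → X) → ℝ≥0∞) :
    ∫⁻ x, F (x ∘ e) ∂(Measure.pi fun _ => ρ) = ∫⁻ x, F x ∂(Measure.pi fun _ => ρ) := by
  have hmp := (measurePreserving_piCongrLeft (fun _ : Fin n => ρ) e).symm
  exact hmp.lintegral_comp_emb (MeasurableEquiv.measurableEmbedding _) F

/-- After the bound of |∏ (1 + f) - 1| by ∑ |f|, symmetry of the Ursell function makes the k + 1
summands have equal integrals. The point touching `y` may thus be taken first, and it becomes the
root of the remaining cluster. -/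
lemma lintegral_zeta_ursell_le (hv : Measurable (Function.uncurry v))
    (hsymm : ∀ x y, v x y = v y x) (hw : Measurable w) (y : X) (k : ℕ) :
    ∫⁻ x, ‖(∏ i, (1 + mayer v y (x i))) - 1‖ₑ * ‖ursell v (k + 1) x‖ₑ * ∏ i, w (x i)
        ∂(Measure.pi fun _ : Fin (k + 1) => ρ) ≤
      (k + 1) * ∫⁻ x, ‖mayer v y x‖ₑ * w x * rootedIntegral v ρ w k x ∂ρ := by
  have hm : ∀ i : Fin (k + 1), Measurable fun x : Fin (k + 1) → X =>
      ‖mayer v y (x i)‖ₑ * (‖ursell v (k + 1) x‖ₑ * ∏ i, w (x i)) := fun i =>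
    (measurable_mayer_comp hv measurable_const (measurable_pi_apply i)).enorm.mul
      ((measurable_ursell hv _).enorm.mul
        (Finset.measurable_prod _ fun j _ => hw.comp (measurable_pi_apply j)))
  calc _ ≤ ∫⁻ x, ∑ i, ‖mayer v y (x i)‖ₑ * (‖ursell v (k + 1) x‖ₑ * ∏ i, w (x i))
        ∂(Measure.pi fun _ : Fin (k + 1) => ρ) := by
        refine lintegral_mono fun x => ?_
        rw [← Finset.sum_mul, mul_assoc]
        gcongr
        exact enorm_zeta_le y x
    _ = ∑ i : Fin (k + 1), ∫⁻ x, ‖mayer v y (x 0)‖ₑ * (‖ursell v (k + 1) x‖ₑ * ∏ i, w (x i))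
        ∂(Measure.pi fun _ : Fin (k + 1) => ρ) := by
        rw [lintegral_finsetSum _ fun i _ => hm i]
        refine Finset.sum_congr rfl fun i _ => ?_
        rw [← lintegral_comp_perm (Equiv.swap 0 i)]
        refine lintegral_congr fun x => ?_
        rw [ursell_comp_perm hsymm]
        congr 2
        · simp
        · exact Equiv.prod_comp (Equiv.swap 0 i) fun j => w (x j)
    _ = _ := by
        rw [Finset.sum_const, Finset.card_univ, Fintype.card_fin, nsmul_eq_mul, Nat.cast_add,
          Nat.cast_one, lintegral_pi_succ (hm 0)]
        congr 1
        refine lintegral_congr fun x => ?_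
        rw [rootedIntegral, ← lintegral_const_mul]
        · refine lintegral_congr fun x' => ?_
          rw [Fin.prod_univ_succ]
          simp only [Fin.cons_zero, Fin.cons_succ]
          ring
        · exact ((measurable_ursell hv _).comp
            (measurable_fin_cons.comp measurable_prodMk_left)).enorm.mul
              (Finset.measurable_prod _ fun i _ => hw.comp (measurable_pi_apply i))

/-- The recursion `ursell_cons_succ` in absolute values: each term factorizes over the two groups of
coordinates, and its integral depends on `U` only through its cardinality. -/
lemma rootedIntegral_succ_le (hv : Measurable (Function.uncurry v))
    (hsymm : ∀ x y, v x y = v y x) (hw : Measurable w) (y : X) (n : ℕ) :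
    rootedIntegral v ρ w (n + 1) y ≤ ∑ k ∈ Finset.range (n + 1), (n.choose k : ℝ≥0∞) *
      (((k + 1) * ∫⁻ x, ‖mayer v y x‖ₑ * w x * rootedIntegral v ρ w k x ∂ρ) *
        rootedIntegral v ρ w (n - k) y) := by
  set F : ∀ k : ℕ, (Fin k → X) → ℝ≥0∞ := fun k x =>
    ‖(∏ i, (1 + mayer v y (x i))) - 1‖ₑ * ‖ursell v k x‖ₑ * ∏ i, w (x i) with hF
  set G : ∀ k : ℕ, (Fin k → X) → ℝ≥0∞ := fun k x =>
    ‖ursell v (k + 1) (Fin.cons y x : Fin (k + 1) → X)‖ₑ * ∏ i, w (x i) with hG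
  have hFm : ∀ k, Measurable (F k) := fun k =>
    (((Finset.measurable_prod _ fun i _ => measurable_const.add (measurable_mayer_comp hv
      measurable_const (measurable_pi_apply i))).sub_const 1).enorm.mul
        (measurable_ursell hv _).enorm).mul
        (Finset.measurable_prod _ fun i _ => hw.comp (measurable_pi_apply i))
  have hGm : ∀ k, Measurable (G k) := fun k =>
    ((measurable_ursell hv _).comp (measurable_fin_cons.comp measurable_prodMk_left)).enorm.mul
      (Finset.measurable_prod _ fun i _ => hw.comp (measurable_pi_apply i))
  calc rootedIntegral v ρ w (n + 1) y
      ≤ ∫⁻ x, ∑ U : Finset (Fin n), F (U.card + 1) (x ∘ leftEmb (splitEquiv U)) *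
          G Uᶜ.card (x ∘ rightEmb (splitEquiv U)) ∂(Measure.pi fun _ : Fin (n + 1) => ρ) := by
        refine lintegral_mono fun x => ?_
        rw [ursell_cons_succ hsymm]
        refine (mul_le_mul_left (enorm_sum_le _ _) _).trans_eq ?_
        rw [Finset.sum_mul]
        refine Finset.sum_congr rfl fun U _ => ?_
        rw [prod_comp_split (splitEquiv U) fun i => w (x i), enorm_mul, enorm_mul]
        simp only [F, G, Function.comp_apply]
        ring
    _ = ∑ U : Finset (Fin n), (∫⁻ x, F (U.card + 1) x ∂(Measure.pi fun _ => ρ)) *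
          ∫⁻ x, G Uᶜ.card x ∂(Measure.pi fun _ => ρ) := by
        rw [lintegral_finsetSum]
        · exact Finset.sum_congr rfl fun U _ => lintegral_split_mul _ (hFm _) (hGm _)
        · exact fun U _ => ((hFm _).comp (measurable_comp_index _)).mul
            ((hGm _).comp (measurable_comp_index _))
    _ = ∑ k ∈ Finset.range (n + 1), (n.choose k : ℝ≥0∞) *
          ((∫⁻ x, F (k + 1) x ∂(Measure.pi fun _ => ρ)) *
            ∫⁻ x, G (n - k) x ∂(Measure.pi fun _ => ρ)) := by
        rw [sum_finset_fin_card n fun k l => (∫⁻ x, F (k + 1) x ∂(Measure.pi fun _ => ρ)) *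
            ∫⁻ x, G l x ∂(Measure.pi fun _ => ρ)]
        simp only [nsmul_eq_mul]
    _ ≤ _ := by
        refine Finset.sum_le_sum fun k _ => ?_
        gcongr
        · exact lintegral_zeta_ursell_le hv hsymm hw y k
        · exact le_rfl

/-- Convergence of the cluster expansion under the Kotecký–Preiss type condition. -/
lemma tsum_rootedIntegral_le (hv : Measurable (Function.uncurry v))
    (hsymm : ∀ x y, v x y = v y x) (hw : Measurable w) {S : Set X} (hwS : ∀ x, x ∉ S → w x = 0)
    {c : X → ℝ≥0}
    (hc : ∀ y ∈ S, ∫⁻ x, ‖mayer v y x‖ₑ * w x * ENNReal.ofReal (Real.exp (c x)) ∂ρ ≤ c y)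
    {y : X} (hy : y ∈ S) :
    ∑' n : ℕ, ((n ! : ℕ) : ℝ≥0∞)⁻¹ * rootedIntegral v ρ w n y ≤
      ENNReal.ofReal (Real.exp (c y)) := by
  set p : ℕ → X → ℝ≥0∞ := fun n y => ((n ! : ℕ) : ℝ≥0∞)⁻¹ * rootedIntegral v ρ w n y with hp
  have hpm : ∀ n, Measurable (p n) := fun n => (measurable_rootedIntegral hv hw n).const_mul _
  have hp0 : ∀ y, p 0 y = 1 := by
    intro y
    simp [hp, rootedIntegral, ursell_one]
  have key : ∀ N, ∀ y ∈ S, ∑ n ∈ Finset.range (N + 1), p n y ≤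
      ENNReal.ofReal (Real.exp (c y)) := by
    intro N
    induction N with
    | zero =>
      intro y _
      simp only [zero_add, Finset.range_one, Finset.sum_singleton, hp0]
      rw [← ENNReal.ofReal_one]
      exact ENNReal.ofReal_le_ofReal (Real.one_le_exp (c y).2)
    | succ N ih =>
      intro y hy
      -- With s_k = ∫ |f(y, x)| w(x) p_k(x), the induction hypothesis bounds the partial sums of p
      -- under the integral by exp(c(x)), so ∑ s_k ≤ c(y) by `hc`. The Grönwall inequality then
      -- returns exp(c(y)), now one order higher.
      refine sum_le_exp_of_recursion (fun n => p n y)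
        (fun k => ∫⁻ x, ‖mayer v y x‖ₑ * w x * p k x ∂ρ) (N + 1) (c y) (hp0 y).le
        (fun n _ => ?_) ?_ (c y).2
      · calc ((n : ℝ≥0∞) + 1) * p (n + 1) y
            = ((n ! : ℕ) : ℝ≥0∞)⁻¹ * rootedIntegral v ρ w (n + 1) y := by
              simp only [hp]
              rw [Nat.factorial_succ, Nat.cast_mul, ENNReal.mul_inv (by simp) (by simp),
                ← mul_assoc, ← mul_assoc, Nat.cast_add, Nat.cast_one,
                ENNReal.mul_inv_cancel (by simp) (by finiteness), one_mul]
          _ ≤ _ := by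
              refine (mul_le_mul_right (rootedIntegral_succ_le hv hsymm hw y n) _).trans_eq ?_
              rw [Finset.mul_sum]
              refine Finset.sum_congr rfl fun k hk => ?_
              rw [inv_factorial_mul_choose (Nat.lt_succ_iff.1 (Finset.mem_range.1 hk))]
              simp only [hp]
              have : ∫⁻ x, ‖mayer v y x‖ₑ * w x *
                  (((k ! : ℕ) : ℝ≥0∞)⁻¹ * rootedIntegral v ρ w k x) ∂ρ =
                  ((k ! : ℕ) : ℝ≥0∞)⁻¹ *
                    ∫⁻ x, ‖mayer v y x‖ₑ * w x * rootedIntegral v ρ w k x ∂ρ := by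
                rw [← lintegral_const_mul' _ _ (by simp [k.factorial_ne_zero])]
                exact lintegral_congr fun x => by ring
              rw [this]
              ring
      · have hm : ∀ k ∈ Finset.range (N + 1),
            Measurable fun x => ‖mayer v y x‖ₑ * w x * p k x := fun k _ =>
          ((measurable_mayer_comp hv measurable_const measurable_id).enorm.mul hw).mul (hpm k)
        rw [← lintegral_finsetSum _ hm, ENNReal.ofReal_coe_nnreal]
        refine le_trans (lintegral_mono fun x => ?_) (hc y hy)
        rw [← Finset.mul_sum]
        -- The induction hypothesis is available only on `S`; elsewhere the weight vanishes.
        by_cases hx : x ∈ S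
        · gcongr
          exact ih x hx
        · simp [hwS x hx]
  rw [ENNReal.tsum_eq_iSup_nat]
  refine iSup_le fun N => ?_
  rcases N with _ | N
  · simp
  · exact key N y hy

/-- The measure of clouds has finite total variation. -/
lemma tsum_lintegral_ursell_lt_top (hv : Measurable (Function.uncurry v))
    (hsymm : ∀ x y, v x y = v y x) (hw : Measurable w) {S : Set X} (hwS : ∀ x, x ∉ S → w x = 0)
    {c : X → ℝ≥0}
    (hc : ∀ y ∈ S, ∫⁻ x, ‖mayer v y x‖ₑ * w x * ENNReal.ofReal (Real.exp (c x)) ∂ρ ≤ c y)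
    (hfin : ∫⁻ x, w x * ENNReal.ofReal (Real.exp (c x)) ∂ρ < ∞) :
    ∑' n : ℕ, ((n ! : ℕ) : ℝ≥0∞)⁻¹ * ∫⁻ x, ‖ursell v (n + 1) x‖ₑ * ∏ i, w (x i)
      ∂(Measure.pi fun _ : Fin (n + 1) => ρ) < ∞ := by
  -- The prefactor 1/n! for n + 1 vertices counts each cluster once per vertex, as for a choice of
  -- root. Integrating the rooted bound exp(c) over the root gives `hfin`.
  refine lt_of_le_of_lt ?_ hfin
  have h : ∀ n : ℕ, ((n ! : ℕ) : ℝ≥0∞)⁻¹ * ∫⁻ x, ‖ursell v (n + 1) x‖ₑ * ∏ i, w (x i)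
      ∂(Measure.pi fun _ : Fin (n + 1) => ρ) =
      ∫⁻ y, w y * (((n ! : ℕ) : ℝ≥0∞)⁻¹ * rootedIntegral v ρ w n y) ∂ρ := by
    intro n
    have hm : Measurable fun x : Fin (n + 1) → X => ‖ursell v (n + 1) x‖ₑ * ∏ i, w (x i) :=
      (measurable_ursell hv _).enorm.mul
        (Finset.measurable_prod _ fun i _ => hw.comp (measurable_pi_apply i))
    rw [lintegral_pi_succ hm,
      ← lintegral_const_mul' _ _ (by simp [n.factorial_ne_zero])]
    refine lintegral_congr fun y => ?_
    have hm' : Measurable fun x : Fin n → X =>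
        ‖ursell v (n + 1) (Fin.cons y x : Fin (n + 1) → X)‖ₑ * ∏ i, w (x i) :=
      ((measurable_ursell hv _).comp
        (measurable_fin_cons.comp measurable_prodMk_left)).enorm.mul
          (Finset.measurable_prod _ fun i _ => hw.comp (measurable_pi_apply i))
    rw [mul_left_comm, rootedIntegral, ← lintegral_const_mul (w y) hm']
    congr 1
    refine lintegral_congr fun x => ?_
    rw [Fin.prod_univ_succ]
    simp only [Fin.cons_zero, Fin.cons_succ]
    ring
  simp only [h]
  have hm : ∀ n : ℕ, AEMeasurable
      (fun y => w y * (((n ! : ℕ) : ℝ≥0∞)⁻¹ * rootedIntegral v ρ w n y)) ρ := fun n =>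
    (hw.mul ((measurable_rootedIntegral hv hw n).const_mul _)).aemeasurable
  rw [← lintegral_tsum hm]
  refine lintegral_mono fun y => ?_
  rw [ENNReal.tsum_mul_left]
  by_cases hy : y ∈ S
  · gcongr
    exact tsum_rootedIntegral_le hv hsymm hw hwS hc hy
  · simp [hwS y hy]

end Bound

/-! ### The partition function as the exponential of the cluster series -/

section ClusterExpansion

variable {X : Type*} {v : X → X → ℝ≥0∞}

lemma boltzmann_mem (n : ℕ) (x : Fin n → X) :
    ∃ r ∈ Set.Icc (0 : ℝ) 1, boltzmann v n x = (r : ℂ) := by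
  refine ⟨_, ⟨?_, ?_⟩, boltzmann_eq_pairProd v n x⟩
  · exact Finset.prod_nonneg fun p _ => (one_add_mayer_mem v _ _).1
  · exact Finset.prod_le_one (fun p _ => (one_add_mayer_mem v _ _).1)
      fun p _ => (one_add_mayer_mem v _ _).2

lemma enorm_boltzmann_le (n : ℕ) (x : Fin n → X) : ‖boltzmann v n x‖ₑ ≤ 1 := by
  obtain ⟨r, hr, h⟩ := boltzmann_mem (v := v) n x
  rw [h, ← ofReal_norm, Complex.norm_of_nonneg hr.1, ENNReal.ofReal_le_one]
  exact hr.2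

lemma enorm_finset_prod {ι : Type*} (s : Finset ι) (g : ι → ℂ) :
    ‖∏ i ∈ s, g i‖ₑ = ∏ i ∈ s, ‖g i‖ₑ := by
  simp only [← ofReal_norm, norm_prod]
  rw [ENNReal.ofReal_prod_of_nonneg fun i _ => norm_nonneg _]

variable [MeasurableSpace X] {ρ : Measure X}

/-- The coefficients of the partition function with activity `u`. -/
def boltzmannCoeff (v : X → X → ℝ≥0∞) (ρ : Measure X) (u : X → ℂ) (n : ℕ) : ℂ :=
  ((n ! : ℕ) : ℂ)⁻¹ * ∫ x, boltzmann v n x * ∏ i, u (x i) ∂(Measure.pi fun _ : Fin n => ρ)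

/-- The coefficients of the cluster expansion with activity `u`, with shifted index. -/
def clusterCoeff (v : X → X → ℝ≥0∞) (ρ : Measure X) (u : X → ℂ) (k : ℕ) : ℂ :=
  (((k + 1)! : ℕ) : ℂ)⁻¹ * ∫ x, (ursell v (k + 1) x : ℂ) * ∏ i, u (x i)
    ∂(Measure.pi fun _ : Fin (k + 1) => ρ)

lemma measurable_prod_comp {u : X → ℂ} (hu : Measurable u) (n : ℕ) :
    Measurable fun x : Fin n → X => ∏ i, u (x i) :=
  Finset.measurable_prod _ fun i _ => hu.comp (measurable_pi_apply i)

lemma lintegral_ursell_le {w : X → ℝ≥0∞} {u : X → ℂ} (huw : ∀ x, ‖u x‖ₑ ≤ w x) (n : ℕ) :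
    ∫⁻ x, ‖(ursell v (n + 1) x : ℂ) * ∏ i, u (x i)‖ₑ ∂(Measure.pi fun _ : Fin (n + 1) => ρ) ≤
      ∫⁻ x, ‖ursell v (n + 1) x‖ₑ * ∏ i, w (x i) ∂(Measure.pi fun _ : Fin (n + 1) => ρ) := by
  refine lintegral_mono fun x => ?_
  rw [enorm_mul, enorm_finset_prod]
  refine mul_le_mul' (le_of_eq ?_) (Finset.prod_le_prod' fun i _ => huw _)
  rw [← ofReal_norm, Complex.norm_real, ofReal_norm]

lemma enorm_inv_natCast {n : ℕ} (hn : n ≠ 0) : ‖((n : ℕ) : ℂ)⁻¹‖ₑ = (n : ℝ≥0∞)⁻¹ := by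
  rw [enorm_inv (by exact_mod_cast hn), ← ofReal_norm, Complex.norm_natCast, ENNReal.ofReal_natCast]

lemma enorm_boltzmannCoeff_le {u : X → ℂ} (n : ℕ) :
    ‖boltzmannCoeff v ρ u n‖ₑ ≤ ((n ! : ℕ) : ℝ≥0∞)⁻¹ * ∫⁻ x, ‖boltzmann v n x * ∏ i, u (x i)‖ₑ
      ∂(Measure.pi fun _ : Fin n => ρ) := by
  rw [boltzmannCoeff, enorm_mul, enorm_inv_natCast n.factorial_ne_zero]
  gcongr
  exact enorm_integral_le_lintegral_enorm _

variable [SigmaFinite ρ]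

lemma lintegral_pi_prod {w : X → ℝ≥0∞} (hw : Measurable w) (n : ℕ) :
    ∫⁻ x, ∏ i, w (x i) ∂(Measure.pi fun _ : Fin n => ρ) = (∫⁻ x, w x ∂ρ) ^ n := by
  induction n with
  | zero => simp
  | succ n ih =>
    have hm : ∀ m : ℕ, Measurable fun x : Fin m → X => ∏ i, w (x i) := fun m =>
      Finset.measurable_prod _ fun i _ => hw.comp (measurable_pi_apply i)
    rw [lintegral_pi_succ (hm _), pow_succ', ← lintegral_mul_const _ hw]
    refine lintegral_congr fun y => ?_
    rw [← ih, ← lintegral_const_mul _ (hm n)]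
    refine lintegral_congr fun x => ?_
    rw [Fin.prod_univ_succ]
    simp

lemma lintegral_boltzmann_le {w : X → ℝ≥0∞} (hw : Measurable w) {u : X → ℂ}
    (huw : ∀ x, ‖u x‖ₑ ≤ w x) (n : ℕ) :
    ∫⁻ x, ‖boltzmann v n x * ∏ i, u (x i)‖ₑ ∂(Measure.pi fun _ : Fin n => ρ) ≤
      (∫⁻ x, w x ∂ρ) ^ n := by
  rw [← lintegral_pi_prod hw]
  refine lintegral_mono fun x => ?_
  rw [enorm_mul, enorm_finset_prod, ← one_mul (∏ i, w (x i))]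
  exact mul_le_mul' (enorm_boltzmann_le n x) (Finset.prod_le_prod' fun i _ => huw _)

lemma integrable_boltzmann_mul (hv : Measurable (Function.uncurry v)) {w : X → ℝ≥0∞}
    (hw : Measurable w) (hwfin : ∫⁻ x, w x ∂ρ < ∞) {u : X → ℂ} (hu : Measurable u)
    (huw : ∀ x, ‖u x‖ₑ ≤ w x) (n : ℕ) :
    Integrable (fun x => boltzmann v n x * ∏ i, u (x i)) (Measure.pi fun _ : Fin n => ρ) :=
  ⟨((measurable_boltzmann hv n).mul (measurable_prod_comp hu n)).aestronglyMeasurable,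
    (lintegral_boltzmann_le hw huw n).trans_lt (ENNReal.pow_lt_top hwfin)⟩

/-- The total mass of the clouds with weight `w` is finite. -/
def CloudSummable (v : X → X → ℝ≥0∞) (ρ : Measure X) (w : X → ℝ≥0∞) : Prop :=
  ∑' n : ℕ, ((n ! : ℕ) : ℝ≥0∞)⁻¹ * ∫⁻ x, ‖ursell v (n + 1) x‖ₑ * ∏ i, w (x i)
      ∂(Measure.pi fun _ : Fin (n + 1) => ρ) < ∞

omit [SigmaFinite ρ] in
lemma integrable_ursell_mul (hv : Measurable (Function.uncurry v)) {w : X → ℝ≥0∞}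
    (hcs : CloudSummable v ρ w) {u : X → ℂ} (hu : Measurable u)
    (huw : ∀ x, ‖u x‖ₑ ≤ w x) (n : ℕ) :
    Integrable (fun x => (ursell v (n + 1) x : ℂ) * ∏ i, u (x i))
      (Measure.pi fun _ : Fin (n + 1) => ρ) := by
  refine ⟨((Complex.measurable_ofReal.comp (measurable_ursell hv _)).mul
    (measurable_prod_comp hu _)).aestronglyMeasurable, (lintegral_ursell_le huw n).trans_lt ?_⟩
  have := ENNReal.ne_top_of_tsum_ne_top hcs.ne n
  rw [lt_top_iff_ne_top]
  intro h
  rw [h, ENNReal.mul_top (by simp)] at this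
  exact this rfl

/-- The integrated form of `boltzmann_succ`: a cluster of k + 1 points containing vertex 0 is chosen
in C(n, k) ways, and the factor n + 1 cancels against the factorial. The activity `u` is merely
dominated by `w`, so the same hypotheses cover every screened activity. -/
lemma boltzmannCoeff_succ (hv : Measurable (Function.uncurry v))
    (hsymm : ∀ x y, v x y = v y x) {w : X → ℝ≥0∞} (hw : Measurable w)
    (hwfin : ∫⁻ x, w x ∂ρ < ∞) (hcs : CloudSummable v ρ w) {u : X → ℂ} (hu : Measurable u)
    (huw : ∀ x, ‖u x‖ₑ ≤ w x) (n : ℕ) :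
    ((n : ℂ) + 1) * boltzmannCoeff v ρ u (n + 1) = ∑ k ∈ Finset.range (n + 1),
      (((k : ℂ) + 1) * clusterCoeff v ρ u k) * boltzmannCoeff v ρ u (n - k) := by
  have hfac : ∀ (m : ℕ) (z : ℂ), ((m : ℂ) + 1) * ((((m + 1)! : ℕ) : ℂ)⁻¹ * z) =
      ((m ! : ℕ) : ℂ)⁻¹ * z := by
    intro m z
    have h1 : ((m : ℂ) + 1) ≠ 0 := by exact_mod_cast m.succ_ne_zero
    have h2 : ((m ! : ℕ) : ℂ) ≠ 0 := by exact_mod_cast m.factorial_ne_zero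
    rw [Nat.factorial_succ]
    push_cast
    field_simp
  set F : ∀ k : ℕ, (Fin k → X) → ℂ := fun k x => (ursell v k x : ℂ) * ∏ i, u (x i) with hF
  set G : ∀ k : ℕ, (Fin k → X) → ℂ := fun k x => boltzmann v k x * ∏ i, u (x i) with hG
  have hFi : ∀ k, Integrable (F (k + 1)) (Measure.pi fun _ => ρ) := fun k =>
    integrable_ursell_mul hv hcs hu huw k
  have hGi : ∀ k, Integrable (G k) (Measure.pi fun _ => ρ) := fun k =>
    integrable_boltzmann_mul hv hw hwfin hu huw k
  have key : ∫ x, G (n + 1) x ∂(Measure.pi fun _ : Fin (n + 1) => ρ) =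
      ∑ k ∈ Finset.range (n + 1), (n.choose k : ℂ) *
        ((∫ x, F (k + 1) x ∂(Measure.pi fun _ => ρ)) *
          ∫ x, G (n - k) x ∂(Measure.pi fun _ => ρ)) := by
    calc _ = ∫ x, ∑ U : Finset (Fin n), F (U.card + 1) (x ∘ leftEmb (splitEquiv U)) *
          G Uᶜ.card (x ∘ rightEmb (splitEquiv U)) ∂(Measure.pi fun _ : Fin (n + 1) => ρ) := by
          refine integral_congr_ae (.of_forall fun x => ?_)
          simp only [hG]
          rw [boltzmann_succ hsymm, Finset.sum_mul]
          refine Finset.sum_congr rfl fun U _ => ?_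
          rw [prod_comp_split (splitEquiv U) fun i => u (x i)]
          simp only [F, Function.comp_apply]
          ring
      _ = ∑ U : Finset (Fin n), (∫ x, F (U.card + 1) x ∂(Measure.pi fun _ => ρ)) *
          ∫ x, G Uᶜ.card x ∂(Measure.pi fun _ => ρ) := by
          rw [integral_finsetSum _ fun U _ => integrable_split_mul _ (hFi _) (hGi _)]
          exact Finset.sum_congr rfl fun U _ => integral_split_mul _ _ _
      _ = _ := by
          rw [sum_finset_fin_card n fun k l => (∫ x, F (k + 1) x ∂(Measure.pi fun _ => ρ)) *
            ∫ x, G l x ∂(Measure.pi fun _ => ρ)]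
          simp only [nsmul_eq_mul]
  rw [boltzmannCoeff, hfac]
  refine (congrArg _ key).trans ?_
  rw [Finset.mul_sum]
  refine Finset.sum_congr rfl fun k hk => ?_
  rw [inv_factorial_mul_choose_complex (Nat.lt_succ_iff.1 (Finset.mem_range.1 hk)),
    clusterCoeff, hfac]
  rfl

omit [SigmaFinite ρ] in
-- The extra factor k + 1, needed to differentiate the cluster series, is affordable because
-- `CloudSummable` carries 1/k! instead of 1/(k + 1)!.
lemma summable_clusterCoeff {w : X → ℝ≥0∞}
    (hcs : CloudSummable v ρ w) {u : X → ℂ} (huw : ∀ x, ‖u x‖ₑ ≤ w x) :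
    Summable fun k : ℕ => ‖((k : ℂ) + 1) * clusterCoeff v ρ u k‖ := by
  refine (ENNReal.summable_toReal hcs.ne).of_nonneg_of_le (fun _ => norm_nonneg _) fun k => ?_
  rw [← toReal_enorm]
  refine ENNReal.toReal_mono (ENNReal.ne_top_of_tsum_ne_top hcs.ne k) ?_
  have h1 : ((k : ℂ) + 1) ≠ 0 := by exact_mod_cast k.succ_ne_zero
  have h2 : ((k ! : ℕ) : ℂ) ≠ 0 := by exact_mod_cast k.factorial_ne_zero
  have : ((k : ℂ) + 1) * clusterCoeff v ρ u k = ((k ! : ℕ) : ℂ)⁻¹ *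
      ∫ x, (ursell v (k + 1) x : ℂ) * ∏ i, u (x i) ∂(Measure.pi fun _ : Fin (k + 1) => ρ) := by
    rw [clusterCoeff, Nat.factorial_succ]
    push_cast
    field_simp
  rw [this, enorm_mul, enorm_inv_natCast k.factorial_ne_zero]
  gcongr
  exact (enorm_integral_le_lintegral_enorm _).trans (lintegral_ursell_le huw k)

/-- Boltzmann factors are at most 1, so the series is dominated by the exponential series of ∫ w. -/
lemma tsum_lintegral_boltzmann_lt_top {w : X → ℝ≥0∞} (hw : Measurable w)
    (hwfin : ∫⁻ x, w x ∂ρ < ∞) {u : X → ℂ} (huw : ∀ x, ‖u x‖ₑ ≤ w x) :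
    ∑' n : ℕ, ((n ! : ℕ) : ℝ≥0∞)⁻¹ * ∫⁻ x, ‖boltzmann v n x * ∏ i, u (x i)‖ₑ
      ∂(Measure.pi fun _ : Fin n => ρ) < ∞ := by
  refine lt_of_le_of_lt (ENNReal.tsum_le_tsum fun n => ?_)
    (Real.summable_pow_div_factorial (∫⁻ x, w x ∂ρ).toReal).tsum_ofReal_lt_top
  refine (mul_le_mul_right (lintegral_boltzmann_le hw huw n) _).trans_eq ?_
  rw [ENNReal.ofReal_div_of_pos (by positivity), ENNReal.ofReal_pow ENNReal.toReal_nonneg,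
    ENNReal.ofReal_toReal hwfin.ne, ENNReal.ofReal_natCast, mul_comm, div_eq_mul_inv]

lemma summable_boltzmannCoeff {w : X → ℝ≥0∞} (hw : Measurable w)
    (hwfin : ∫⁻ x, w x ∂ρ < ∞) {u : X → ℂ} (huw : ∀ x, ‖u x‖ₑ ≤ w x) :
    Summable fun n : ℕ => ‖(n : ℂ) * boltzmannCoeff v ρ u n‖ := by
  rw [← summable_nat_add_iff 1]
  set M := (∫⁻ x, w x ∂ρ).toReal
  refine ((Real.summable_pow_div_factorial M).mul_left M).of_nonneg_of_le
    (fun _ => norm_nonneg _) fun n => ?_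
  have hle : ‖boltzmannCoeff v ρ u (n + 1)‖ ≤ (((n + 1)! : ℕ) : ℝ)⁻¹ * M ^ (n + 1) := by
    rw [← toReal_enorm]
    refine (ENNReal.toReal_mono ?_ ((enorm_boltzmannCoeff_le (n + 1)).trans
      (mul_le_mul_right (lintegral_boltzmann_le hw huw (n + 1)) _))).trans_eq ?_
    · exact ENNReal.mul_ne_top (by simp [Nat.factorial_ne_zero]) (ENNReal.pow_ne_top hwfin.ne)
    · simp [M]
  rw [norm_mul, Complex.norm_natCast]
  refine (mul_le_mul_of_nonneg_left hle (Nat.cast_nonneg _)).trans_eq ?_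
  have h2 : ((n ! : ℕ) : ℝ) ≠ 0 := by exact_mod_cast n.factorial_ne_zero
  have h1 : ((n : ℝ) + 1) ≠ 0 := by exact_mod_cast n.succ_ne_zero
  rw [Nat.factorial_succ]
  push_cast
  field_simp
  ring

/-- The cluster expansion of the logarithm of the partition function. -/
lemma tsum_boltzmannCoeff_eq_exp (hv : Measurable (Function.uncurry v))
    (hsymm : ∀ x y, v x y = v y x) {w : X → ℝ≥0∞} (hw : Measurable w)
    (hwfin : ∫⁻ x, w x ∂ρ < ∞) (hcs : CloudSummable v ρ w) {u : X → ℂ} (hu : Measurable u)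
    (huw : ∀ x, ‖u x‖ₑ ≤ w x) :
    ∑' n, boltzmannCoeff v ρ u n = Complex.exp (∑' k, clusterCoeff v ρ u k) := by
  refine tsum_eq_exp_of_recursion _ _ (summable_boltzmannCoeff hw hwfin huw)
    (summable_clusterCoeff hcs huw) ?_ (boltzmannCoeff_succ hv hsymm hw hwfin hcs hu huw)
  simp [boltzmannCoeff, boltzmann, Measure.real]

/-- For nonnegative activities the partition function is the sum of the absolute values. -/
lemma enorm_tsum_boltzmannCoeff (hv : Measurable (Function.uncurry v)) {w : X → ℝ≥0∞}
    (hw : Measurable w) (hwfin : ∫⁻ x, w x ∂ρ < ∞) {u : X → ℂ} (hu : Measurable u)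
    (huw : ∀ x, ‖u x‖ₑ ≤ w x) (hpos : ∀ x, u x = (‖u x‖ : ℂ)) :
    ‖∑' n, boltzmannCoeff v ρ u n‖ₑ = ∑' n : ℕ, ((n ! : ℕ) : ℝ≥0∞)⁻¹ *
      ∫⁻ x, ‖boltzmann v n x * ∏ i, u (x i)‖ₑ ∂(Measure.pi fun _ : Fin n => ρ) := by
  have h : ∀ (n : ℕ) (x : Fin n → X), boltzmann v n x * ∏ i, u (x i) =
      (‖boltzmann v n x * ∏ i, u (x i)‖ : ℂ) := by
    intro n x
    obtain ⟨r, hr, hb⟩ := boltzmann_mem (v := v) n x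
    rw [norm_mul, norm_prod, hb, Complex.norm_of_nonneg hr.1, Complex.ofReal_mul,
      Complex.ofReal_prod]
    simp only [← hpos]
  set t : ℕ → ℝ := fun n => ((n ! : ℕ) : ℝ)⁻¹ *
    ∫ x, ‖boltzmann v n x * ∏ i, u (x i)‖ ∂(Measure.pi fun _ : Fin n => ρ) with ht
  have ht0 : ∀ n, 0 ≤ t n := fun n =>
    mul_nonneg (by positivity) (integral_nonneg fun _ => norm_nonneg _)
  have h1 : ∀ n, boltzmannCoeff v ρ u n = (t n : ℂ) := by
    intro n
    rw [boltzmannCoeff, integral_congr_ae (.of_forall (h n)), integral_complex_ofReal]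
    simp [t]
  have h2 : ∀ n : ℕ, ((n ! : ℕ) : ℝ≥0∞)⁻¹ *
      ∫⁻ x, ‖boltzmann v n x * ∏ i, u (x i)‖ₑ ∂(Measure.pi fun _ : Fin n => ρ) =
      ENNReal.ofReal (t n) := by
    intro n
    rw [ENNReal.ofReal_mul (by positivity), ofReal_integral_norm_eq_lintegral_enorm
      (integrable_boltzmann_mul hv hw hwfin hu huw n),
      ENNReal.ofReal_inv_of_pos (by positivity), ENNReal.ofReal_natCast]
  have hsum : Summable t := by
    have := tsum_lintegral_boltzmann_lt_top (v := v) hw hwfin huw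
    simp only [h2] at this
    have := ENNReal.summable_toReal this.ne
    simpa only [ENNReal.toReal_ofReal (ht0 _)] using this
  simp only [h1, h2]
  rw [← Complex.ofReal_tsum, ← ENNReal.ofReal_tsum_of_nonneg ht0 hsum, ← ofReal_norm,
    Complex.norm_of_nonneg (tsum_nonneg ht0)]

end ClusterExpansion

/-! ### Restriction of the measure as an indicator in the density -/

section Restrict

variable {X : Type*} [MeasurableSpace X] (μ : DensityMeasure X) [SigmaFinite μ.base] {S : Set X}

omit [MeasurableSpace X] in
lemma prod_indicator_eq {M : Type*} [CommMonoidWithZero M] {n : ℕ} (S : Set X) (u : X → M)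
    (x : Fin n → X) : ∏ i, S.indicator u (x i) =
      (Set.univ.pi fun _ : Fin n => S).indicator (fun x => ∏ i, u (x i)) x := by
  classical
  by_cases h : x ∈ Set.univ.pi fun _ : Fin n => S
  · rw [Set.indicator_of_mem h]
    exact Finset.prod_congr rfl fun i _ => Set.indicator_of_mem (h i (Set.mem_univ i)) _
  · rw [Set.indicator_of_notMem h]
    simp only [Set.mem_pi, Set.mem_univ, true_imp_iff, not_forall] at h
    obtain ⟨i, hi⟩ := h
    exact Finset.prod_eq_zero (Finset.mem_univ i) (Set.indicator_of_notMem hi _)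

omit [MeasurableSpace X] in
lemma mul_prod_indicator_eq {n : ℕ} (S : Set X) (u : X → ℂ) (F : (Fin n → X) → ℂ) :
    (fun x => F x * ∏ i, S.indicator u (x i)) =
      (Set.univ.pi fun _ : Fin n => S).indicator (fun x => F x * ∏ i, u (x i)) := by
  funext x
  rw [prod_indicator_eq, Set.indicator_mul_right]

lemma restrict_pow_base (n : ℕ) : ((μ.restrict S).pow n).base =
    (Measure.pi fun _ : Fin n => μ.base).restrict (Set.univ.pi fun _ => S) :=
  (Measure.restrict_pi_pi _ _).symm

lemma restrict_pow_integral (hS : MeasurableSet S) {n : ℕ} (F : (Fin n → X) → ℂ) :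
    ((μ.restrict S).pow n).integral F =
      ∫ x, F x * ∏ i, S.indicator μ.density (x i) ∂(Measure.pi fun _ : Fin n => μ.base) := by
  rw [DensityMeasure.integral, restrict_pow_base, mul_prod_indicator_eq,
    integral_indicator (MeasurableSet.univ_pi fun _ => hS)]
  rfl

lemma restrict_pow_absIntegral (hS : MeasurableSet S) {n : ℕ} (F : (Fin n → X) → ℂ) :
    ((μ.restrict S).pow n).absIntegral F =
      ∫⁻ x, ‖F x * ∏ i, S.indicator μ.density (x i)‖ₑ
        ∂(Measure.pi fun _ : Fin n => μ.base) := by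
  have h : ∀ x, ‖F x * ∏ i, S.indicator μ.density (x i)‖ₑ =
      (Set.univ.pi fun _ : Fin n => S).indicator (fun x => ‖F x * ∏ i, μ.density (x i)‖ₑ) x := by
    intro x
    rw [← enorm_indicator_eq_indicator_enorm]
    exact congrArg _ (congrFun (mul_prod_indicator_eq S μ.density F) x)
  rw [DensityMeasure.absIntegral, restrict_pow_base, lintegral_congr h,
    lintegral_indicator (MeasurableSet.univ_pi fun _ => hS)]
  rfl

lemma restrict_pow_absIntegrable (hS : MeasurableSet S) {n : ℕ} (F : (Fin n → X) → ℂ) :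
    ((μ.restrict S).pow n).AbsIntegrable F ↔
      Integrable (fun x => F x * ∏ i, S.indicator μ.density (x i))
        (Measure.pi fun _ : Fin n => μ.base) := by
  rw [DensityMeasure.AbsIntegrable, restrict_pow_base, mul_prod_indicator_eq,
    integrable_indicator_iff (MeasurableSet.univ_pi fun _ => hS)]
  rfl

lemma restrict_gcSum (hS : MeasurableSet S) (v : X → X → ℝ≥0∞) :
    (μ.restrict S).gcSum (boltzmann v) =
      ∑' n, boltzmannCoeff v μ.base (S.indicator μ.density) n := by
  simp only [DensityMeasure.gcSum, restrict_pow_integral μ hS]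
  rfl

lemma restrict_gcAbsSum (hS : MeasurableSet S) (F : ∀ n : ℕ, (Fin n → X) → ℂ) :
    (μ.restrict S).gcAbsSum F = ∑' n : ℕ, ((n ! : ℕ) : ℝ≥0∞)⁻¹ *
      ∫⁻ x, ‖F n x * ∏ i, S.indicator μ.density (x i)‖ₑ
        ∂(Measure.pi fun _ : Fin n => μ.base) := by
  simp only [DensityMeasure.gcAbsSum, restrict_pow_absIntegral μ hS]

end Restrict

/-! ### Integrals over clouds and the screened activity -/

section Cloud

variable {X : Type*} [MeasurableSpace X]

lemma measurable_sigmaMk (k : ℕ) : Measurable fun y : Fin (k + 1) → X => (⟨k, y⟩ : Cloud X) :=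
  fun _ hs => MeasurableSpace.measurableSet_iInf.1 hs k

lemma measurable_of_cloud {E : Type*} [MeasurableSpace E] {h : Cloud X → E}
    (hh : ∀ k, Measurable fun y : Fin (k + 1) → X => h ⟨k, y⟩) : Measurable h :=
  fun _ hs => MeasurableSpace.measurableSet_iInf.2 fun k => hh k hs

variable {v : X → X → ℝ≥0∞} {μ : DensityMeasure X} [SigmaFinite μ.base] {Xs : Set X}

variable (v μ Xs) in
omit [SigmaFinite μ.base] in
lemma cloudMeasure_base : (cloudMeasure v μ Xs).base =
    Measure.sum fun k : ℕ => (((k + 1)! : ℕ) : ℝ≥0∞)⁻¹ •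
      ((μ.restrict Xs).pow (k + 1)).base.map fun y => (⟨k, y⟩ : Cloud X) := rfl

lemma measurable_zeta (hv : Measurable (Function.uncurry v)) (x : X) : Measurable (zeta v x) :=
  measurable_of_cloud fun k => by
    have h : ∀ i, Measurable fun y : Fin (k + 1) → X => 1 + mayer v x (y i) := fun i =>
      measurable_const.add (measurable_mayer_comp hv measurable_const (measurable_pi_apply i))
    exact Complex.measurable_ofReal.comp
      ((Finset.measurable_prod Finset.univ fun i _ => h i).sub_const 1)

omit [MeasurableSpace X] in
-- With this bound, absolute convergence of all cloud integrals in question follows from the finite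
-- total variation of ν alone.
lemma enorm_zeta_le_one (x : X) (Y : Cloud X) : ‖zeta v x Y‖ₑ ≤ 1 := by
  rw [zeta, ← ofReal_norm, Complex.norm_real, ENNReal.ofReal_le_one, Real.norm_eq_abs, abs_le]
  have h0 : 0 ≤ ∏ j, (1 + mayer v x (Y.2 j)) :=
    Finset.prod_nonneg fun i _ => (one_add_mayer_mem v _ _).1
  have h1 : ∏ j, (1 + mayer v x (Y.2 j)) ≤ 1 :=
    Finset.prod_le_one (fun i _ => (one_add_mayer_mem v _ _).1)
      fun i _ => (one_add_mayer_mem v _ _).2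
  constructor <;> linarith

omit [SigmaFinite μ.base] in
lemma measurable_cloud_density (hv : Measurable (Function.uncurry v)) (hμ : Measurable μ.density) :
    Measurable (cloudMeasure v μ Xs).density :=
  measurable_of_cloud fun _ => (Complex.measurable_ofReal.comp (measurable_ursell hv _)).mul
    (measurable_prod_comp hμ _)

/-- Bounded measurable functions are integrable with respect to the measure on clouds. -/
lemma cloud_absIntegrable (hv : Measurable (Function.uncurry v)) (hμ : Measurable μ.density)
    (hXs : MeasurableSet Xs)
    (hcs : CloudSummable v μ.base fun x => ‖Xs.indicator μ.density x‖ₑ)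
    {h : Cloud X → ℂ} (hh : Measurable h) (hb : ∀ Y, ‖h Y‖ₑ ≤ 1) :
    (cloudMeasure v μ Xs).AbsIntegrable h := by
  have hm : Measurable fun Y => h Y * (cloudMeasure v μ Xs).density Y :=
    hh.mul (measurable_cloud_density hv hμ)
  refine ⟨hm.aestronglyMeasurable, lt_of_le_of_lt ?_ hcs⟩
  rw [cloudMeasure_base, lintegral_sum_measure]
  refine ENNReal.tsum_le_tsum fun k => ?_
  rw [lintegral_smul_measure, smul_eq_mul,
    lintegral_map hm.enorm (measurable_sigmaMk k)]
  refine mul_le_mul' ?_ ?_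
  -- ν carries 1/(k + 1)!, which is at most the 1/k! of `CloudSummable`.
  · exact ENNReal.inv_le_inv.2 (Nat.cast_le.2 (Nat.factorial_le (Nat.le_succ k)))
  · refine le_trans (lintegral_mono fun y => ?_) ((restrict_pow_absIntegral μ hXs
      (fun y => (ursell v (k + 1) y : ℂ))).trans_le
        (lintegral_ursell_le (w := fun x => ‖Xs.indicator μ.density x‖ₑ) (fun x => le_rfl) k))
    rw [enorm_mul]
    exact (mul_le_mul_left (hb _) _).trans_eq (one_mul _)

lemma cloud_integral (hv : Measurable (Function.uncurry v)) (hμ : Measurable μ.density)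
    (hXs : MeasurableSet Xs)
    (hcs : CloudSummable v μ.base fun x => ‖Xs.indicator μ.density x‖ₑ)
    {h : Cloud X → ℂ} (hh : Measurable h) (hb : ∀ Y, ‖h Y‖ₑ ≤ 1) :
    (cloudMeasure v μ Xs).integral h = ∑' k : ℕ, (((k + 1)! : ℕ) : ℂ)⁻¹ *
      ∫ y, h ⟨k, y⟩ * ursell v (k + 1) y * ∏ i, Xs.indicator μ.density (y i)
        ∂(Measure.pi fun _ : Fin (k + 1) => μ.base) := by
  have hm : Measurable fun Y => h Y * (cloudMeasure v μ Xs).density Y :=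
    hh.mul (measurable_cloud_density hv hμ)
  have hint := cloud_absIntegrable hv hμ hXs hcs hh hb
  rw [DensityMeasure.AbsIntegrable, cloudMeasure_base] at hint
  rw [DensityMeasure.integral, cloudMeasure_base, ← (hasSum_integral_measure hint).tsum_eq]
  refine tsum_congr fun k => ?_
  rw [integral_smul_measure, integral_map (measurable_sigmaMk k).aemeasurable
    hm.aestronglyMeasurable, ← restrict_pow_integral μ hXs (fun y => h ⟨k, y⟩ * ursell v (k + 1) y),
    DensityMeasure.integral]
  simp only [ENNReal.toReal_inv, ENNReal.toReal_natCast, Complex.real_smul, Complex.ofReal_inv,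
    Complex.ofReal_natCast, mul_assoc]
  rfl

/-- The activity `z(y) ∏_j (1 + f(x_j, y))` of small objects in the presence of large objects. -/
def screenedActivity (v : X → X → ℝ≥0∞) (z : X → ℂ) {m : ℕ} (x : Fin m → X) (y : X) : ℂ :=
  (∏ j, ((1 + mayer v (x j) y : ℝ) : ℂ)) * z y

lemma measurable_screenedActivity (hv : Measurable (Function.uncurry v)) {z : X → ℂ}
    (hz : Measurable z) (m : ℕ) :
    Measurable fun p : (Fin m → X) × X => screenedActivity v z p.1 p.2 :=
  (Finset.measurable_prod _ fun j _ => Complex.measurable_ofReal.comp (measurable_const.add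
    (measurable_mayer_comp hv ((measurable_pi_apply j).comp measurable_fst) measurable_snd))).mul
    (hz.comp measurable_snd)

omit [MeasurableSpace X] in
lemma enorm_screenedActivity_le (z : X → ℂ) {m : ℕ} (x : Fin m → X) (y : X) :
    ‖screenedActivity v z x y‖ₑ ≤ ‖z y‖ₑ := by
  rw [screenedActivity, enorm_mul, enorm_finset_prod]
  refine (mul_le_mul_left (Finset.prod_le_one' fun j _ => ?_) _).trans_eq (one_mul _)
  rw [← ofReal_norm, Complex.norm_of_nonneg (one_add_mayer_mem v _ _).1, ENNReal.ofReal_le_one]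
  exact (one_add_mayer_mem v _ _).2

omit [MeasurableSpace X] in
lemma prod_zeta_add_one {m : ℕ} (x : Fin m → X) {k : ℕ} (y : Fin (k + 1) → X) :
    ∏ j, (1 + zeta v (x j) ⟨k, y⟩) = ∏ i, ∏ j, ((1 + mayer v (x j) (y i) : ℝ) : ℂ) := by
  rw [Finset.prod_comm]
  refine Finset.prod_congr rfl fun j _ => ?_
  rw [zeta]
  push_cast
  ring

/-- Each point y of a cloud contributes ∏_j (1 + f(x_j, y)); exchanging the products over points and
large objects gives ∏_j (1 + ζ(x_j, Y)). -/
lemma tsum_clusterCoeff_screenedActivity (hv : Measurable (Function.uncurry v))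
    (hμ : Measurable μ.density) (hXs : MeasurableSet Xs)
    (hcs : CloudSummable v μ.base fun x => ‖Xs.indicator μ.density x‖ₑ) {m : ℕ} (x : Fin m → X) :
    ∑' k, clusterCoeff v μ.base (screenedActivity v (Xs.indicator μ.density) x) k =
      (cloudMeasure v μ Xs).integral fun Y => ∏ j, (1 + zeta v (x j) Y) := by
  rw [cloud_integral hv hμ hXs hcs]
  · refine tsum_congr fun k => ?_
    rw [clusterCoeff]
    congr 1
    refine integral_congr_ae (.of_forall fun y => ?_)
    simp only [screenedActivity, prod_zeta_add_one, Finset.prod_mul_distrib]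
    ring
  · exact Finset.measurable_prod _ fun j _ => measurable_const.add (measurable_zeta hv _)
  · rintro ⟨k, y⟩
    rw [prod_zeta_add_one, enorm_finset_prod]
    refine Finset.prod_le_one' fun i _ => ?_
    rw [enorm_finset_prod]
    refine Finset.prod_le_one' fun j _ => ?_
    rw [← ofReal_norm, Complex.norm_of_nonneg (one_add_mayer_mem v _ _).1, ENNReal.ofReal_le_one]
    exact (one_add_mayer_mem v _ _).2

omit [MeasurableSpace X] in
lemma enorm_prod_zeta_le_one {J : Type*} (s : Finset J) (x : J → X) (Y : Cloud X) :
    ‖∏ j ∈ s, zeta v (x j) Y‖ₑ ≤ 1 := by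
  rw [enorm_finset_prod]
  exact Finset.prod_le_one' fun j _ => enorm_zeta_le_one _ _

/-- The expansion of the cloud integral into the effective activities and interactions. -/
lemma cloud_integral_prod_one_add_zeta (hv : Measurable (Function.uncurry v))
    (hμ : Measurable μ.density) (hXs : MeasurableSet Xs)
    (hcs : CloudSummable v μ.base fun x => ‖Xs.indicator μ.density x‖ₑ) {m : ℕ} (x : Fin m → X) :
    ((cloudMeasure v μ Xs).integral fun Y => ∏ j, (1 + zeta v (x j) Y)) =
      (cloudMeasure v μ Xs).integral (fun _ => 1) +
        ((∑ j, (cloudMeasure v μ Xs).integral (zeta v (x j))) -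
          ∑ J : Finset (Fin m) with 2 ≤ J.card,
            multibodyW v μ Xs fun j : {j // j ∈ J} => x j) := by
  set I : Finset (Fin m) → ℂ := fun J =>
    (cloudMeasure v μ Xs).integral fun Y => ∏ j ∈ J, zeta v (x j) Y with hI
  have h1 : ((cloudMeasure v μ Xs).integral fun Y => ∏ j, (1 + zeta v (x j) Y)) =
      ∑ J : Finset (Fin m), I J := by
    simp only [hI, DensityMeasure.integral]
    rw [← integral_finsetSum]
    · simp only [Finset.prod_one_add, Finset.powerset_univ, Finset.sum_mul]
    · exact fun J _ => cloud_absIntegrable hv hμ hXs hcs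
        (Finset.measurable_prod _ fun j _ => measurable_zeta hv _) (enorm_prod_zeta_le_one J x)
  have h2 : (∑ J : Finset (Fin m) with 2 ≤ J.card,
      multibodyW v μ Xs fun j : {j // j ∈ J} => x j) =
      -∑ J : Finset (Fin m) with 2 ≤ J.card, I J := by
    rw [← Finset.sum_neg_distrib]
    refine Finset.sum_congr rfl fun J _ => ?_
    rw [multibodyW]
    congr 2
    funext Y
    exact Finset.prod_coe_sort J fun j => zeta v (x j) Y
  -- The subsets of size 0 and 1 are set apart: they give the total mass of ν and the exponents of
  -- the effective activities.
  have h3 : ∑ J : Finset (Fin m) with ¬ 2 ≤ J.card, I J = I ∅ + ∑ j, I {j} := by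
    have hset : (Finset.univ.filter fun J : Finset (Fin m) => ¬ 2 ≤ J.card) =
        insert ∅ (Finset.univ.map ⟨fun j => {j}, Finset.singleton_injective⟩) := by
      ext J
      simp only [Finset.mem_filter, Finset.mem_univ, true_and, Finset.mem_insert, Finset.mem_map,
        Function.Embedding.coeFn_mk, not_le]
      constructor
      · intro h
        rcases Nat.lt_or_ge J.card 1 with h' | h'
        · exact Or.inl (Finset.card_eq_zero.1 (by omega))
        · obtain ⟨j, hj⟩ := Finset.card_eq_one.1 (show J.card = 1 by omega)
          exact Or.inr ⟨j, hj.symm⟩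
      · rintro (rfl | ⟨j, rfl⟩) <;> simp
    rw [hset, Finset.sum_insert (by simp), Finset.sum_map]
    rfl
  rw [h1, h2, ← Finset.sum_filter_add_sum_filter_not _ fun J : Finset (Fin m) => 2 ≤ J.card, h3]
  simp only [hI, Finset.prod_empty, Finset.prod_singleton]
  ring

end Cloud

/-! ### Rearrangement of double series -/

section DoubleSeries

lemma ennreal_tsum_sum_range (g : ℕ → ℕ → ℝ≥0∞) :
    ∑' n, ∑ k ∈ Finset.range (n + 1), g k (n - k) = ∑' k, ∑' l, g k l := by
  rw [← ENNReal.tsum_prod (f := g), ← Finset.HasAntidiagonal.sigmaAntidiagonalEquivProd.tsum_eq,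
    ENNReal.tsum_sigma']
  refine tsum_congr fun n => ?_
  rw [← Finset.Nat.sum_antidiagonal_eq_sum_range_succ g, tsum_fintype]
  exact (Finset.sum_finset_coe (fun p : ℕ × ℕ => g p.1 p.2) (Finset.HasAntidiagonal.antidiagonal n)).symm

lemma complex_tsum_sum_range {g : ℕ → ℕ → ℂ} (hg : ∑' k, ∑' l, ‖g k l‖ₑ < ∞) :
    ∑' n, ∑ k ∈ Finset.range (n + 1), g k (n - k) = ∑' k, ∑' l, g k l := by
  have hs : Summable fun p : ℕ × ℕ => g p.1 p.2 := by
    rw [← ENNReal.tsum_prod (f := fun k l => ‖g k l‖ₑ)] at hg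
    have := ENNReal.summable_toReal hg.ne
    simp only [toReal_enorm] at this
    exact this.of_norm
  rw [← hs.tsum_prod, ← Finset.HasAntidiagonal.sigmaAntidiagonalEquivProd.tsum_eq
    (fun p : ℕ × ℕ => g p.1 p.2)]
  refine Eq.trans ?_ (Eq.symm (Summable.tsum_sigma' ?_ ?_))
  rotate_left
  · exact fun n => (hasSum_fintype _).summable
  · exact Finset.HasAntidiagonal.sigmaAntidiagonalEquivProd.summable_iff.2 hs
  refine tsum_congr fun n => ?_
  rw [← Finset.Nat.sum_antidiagonal_eq_sum_range_succ g, tsum_fintype]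
  exact (Finset.sum_finset_coe (fun p : ℕ × ℕ => g p.1 p.2) (Finset.HasAntidiagonal.antidiagonal n)).symm

end DoubleSeries

/-! ### Separation of large and small objects -/

section TwoSpecies

lemma pairProd_union {ι : Type*} [LinearOrder ι] {f : ι → ι → ℝ} (hf : ∀ i j, f i j = f j i)
    {A B : Finset ι} (h : Disjoint A B) :
    pairProd f (A ∪ B) = pairProd f A * pairProd f B * ∏ j ∈ B, ∏ i ∈ A, (1 + f i j) := by
  induction A using Finset.induction_on with
  | empty => simp [pairProd_empty]
  | insert a A ha ih =>
    rw [Finset.disjoint_insert_left] at h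
    rw [Finset.insert_union, pairProd_insert hf (by simp [ha, h.1]), ih h.2, pairProd_insert hf ha,
      Finset.prod_union h.2]
    simp only [Finset.prod_insert ha, Finset.prod_mul_distrib]
    ring

/-- The decomposition of `Fin n` into `U` and its complement. -/
def complEquiv {n : ℕ} (U : Finset (Fin n)) : Fin U.card ⊕ Fin Uᶜ.card ≃ Fin n :=
  finSumEquivOfFinset rfl rfl

lemma map_leftEmb_complEquiv {n : ℕ} (U : Finset (Fin n)) :
    Finset.univ.map (leftEmb (complEquiv U)) = U := map_leftEmb_finSumEquivOfFinset _ _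

lemma map_rightEmb_complEquiv {n : ℕ} (U : Finset (Fin n)) :
    Finset.univ.map (rightEmb (complEquiv U)) = Uᶜ := map_rightEmb_finSumEquivOfFinset _ _

lemma prod_add_split {M : Type*} [CommSemiring M] {n : ℕ} (a b : Fin n → M) :
    ∏ i, (a i + b i) = ∑ U : Finset (Fin n),
      (∏ i, a (leftEmb (complEquiv U) i)) * ∏ i, b (rightEmb (complEquiv U) i) := by
  rw [Finset.prod_add, Finset.powerset_univ]
  refine Finset.sum_congr rfl fun U _ => ?_
  rw [← Finset.prod_map Finset.univ (leftEmb (complEquiv U)) a, map_leftEmb_complEquiv,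
    ← Finset.prod_map Finset.univ (rightEmb (complEquiv U)) b, map_rightEmb_complEquiv,
    Finset.compl_eq_univ_sdiff]

variable {X : Type*} {v : X → X → ℝ≥0∞}

lemma boltzmann_split (hsymm : ∀ x y, v x y = v y x) {n : ℕ} (U : Finset (Fin n))
    (x : Fin n → X) : boltzmann v n x =
      boltzmann v U.card (x ∘ leftEmb (complEquiv U)) *
        boltzmann v Uᶜ.card (x ∘ rightEmb (complEquiv U)) *
        ∏ i, ∏ j, ((1 + mayer v (x (leftEmb (complEquiv U) j))
          (x (rightEmb (complEquiv U) i)) : ℝ) : ℂ) := by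
  rw [boltzmann_eq_pairProd, ← Finset.union_compl U,
    pairProd_union (fun i j => mayer_comm hsymm _ _) disjoint_compl_right, Complex.ofReal_mul,
    Complex.ofReal_mul, ← pairProd_eq_boltzmann hsymm, ← pairProd_eq_boltzmann hsymm,
    map_leftEmb_complEquiv, map_rightEmb_complEquiv]
  congr 1
  nth_rewrite 1 [← map_rightEmb_complEquiv U]
  rw [Finset.prod_map, Complex.ofReal_prod]
  refine Finset.prod_congr rfl fun i _ => ?_
  nth_rewrite 1 [← map_leftEmb_complEquiv U]
  rw [Finset.prod_map, Complex.ofReal_prod]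

/-- The integrand for `k` large and `l` small objects. -/
def twoSpecies (v : X → X → ℝ≥0∞) (zl zs : X → ℂ) (k l : ℕ)
    (p : (Fin k → X) × (Fin l → X)) : ℂ :=
  (boltzmann v k p.1 * ∏ i, zl (p.1 i)) *
    (boltzmann v l p.2 * ∏ i, screenedActivity v zs p.1 (p.2 i))

/-- The interactions between the two species are absorbed in the screened activities of the small
objects. -/
lemma twoSpecies_split (hsymm : ∀ x y, v x y = v y x) (zl zs : X → ℂ) {n : ℕ}
    (U : Finset (Fin n)) (x : Fin n → X) :
    twoSpecies v zl zs U.card Uᶜ.card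
      (x ∘ leftEmb (complEquiv U), x ∘ rightEmb (complEquiv U)) =
      boltzmann v n x * ((∏ i, zl (x (leftEmb (complEquiv U) i))) *
        ∏ i, zs (x (rightEmb (complEquiv U) i))) := by
  rw [boltzmann_split hsymm U, twoSpecies]
  simp only [screenedActivity, Finset.prod_mul_distrib, Function.comp_apply]
  ring

lemma boltzmann_mul_eq_sum (hsymm : ∀ x y, v x y = v y x) {z zl zs : X → ℂ}
    (hz : ∀ x, z x = zl x + zs x) {n : ℕ} (x : Fin n → X) :
    boltzmann v n x * ∏ i, z (x i) = ∑ U : Finset (Fin n), twoSpecies v zl zs U.card Uᶜ.card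
      (x ∘ leftEmb (complEquiv U), x ∘ rightEmb (complEquiv U)) := by
  simp only [hz, prod_add_split (fun i => zl (x i)), twoSpecies_split hsymm, Finset.mul_sum]

/-- Additivity of the norms, which holds for densities with disjoint supports, makes this an
equality. This exactness is what later permits an identity in [0, ∞]. -/
lemma enorm_boltzmann_mul_eq_sum (hsymm : ∀ x y, v x y = v y x) {z zl zs : X → ℂ}
    (hz : ∀ x, ‖z x‖ₑ = ‖zl x‖ₑ + ‖zs x‖ₑ) {n : ℕ} (x : Fin n → X) :
    ‖boltzmann v n x * ∏ i, z (x i)‖ₑ = ∑ U : Finset (Fin n), ‖twoSpecies v zl zs U.card Uᶜ.card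
      (x ∘ leftEmb (complEquiv U), x ∘ rightEmb (complEquiv U))‖ₑ := by
  simp only [twoSpecies_split hsymm, enorm_mul, enorm_finset_prod, hz,
    prod_add_split (fun i => ‖zl (x i)‖ₑ), Finset.mul_sum]

variable [MeasurableSpace X] {ρ : Measure X} [SigmaFinite ρ]

lemma measurable_boltzmann_screened (hv : Measurable (Function.uncurry v)) {zs : X → ℂ}
    (hzs : Measurable zs) (k l : ℕ) : Measurable fun p : (Fin k → X) × (Fin l → X) =>
      boltzmann v l p.2 * ∏ i, screenedActivity v zs p.1 (p.2 i) := by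
  have h1 : Measurable fun p : (Fin k → X) × (Fin l → X) => boltzmann v l p.2 :=
    (measurable_boltzmann hv l).comp measurable_snd
  have h2 : ∀ i, Measurable fun p : (Fin k → X) × (Fin l → X) =>
      screenedActivity v zs p.1 (p.2 i) := fun i => by
    have hp : Measurable fun p : (Fin k → X) × (Fin l → X) => (p.1, p.2 i) :=
      measurable_fst.prodMk ((measurable_pi_apply i).comp measurable_snd)
    exact Measurable.comp (f := fun p : (Fin k → X) × (Fin l → X) => (p.1, p.2 i))
      (measurable_screenedActivity hv hzs k) hp
  exact h1.mul (Finset.measurable_prod _ fun i _ => h2 i)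

lemma measurable_twoSpecies (hv : Measurable (Function.uncurry v)) {zl zs : X → ℂ}
    (hzl : Measurable zl) (hzs : Measurable zs) (k l : ℕ) : Measurable (twoSpecies v zl zs k l) := by
  have h1 : Measurable fun p : (Fin k → X) × (Fin l → X) =>
      boltzmann v k p.1 * ∏ i, zl (p.1 i) :=
    ((measurable_boltzmann hv k).mul (measurable_prod_comp hzl k)).comp measurable_fst
  exact h1.mul (measurable_boltzmann_screened hv hzs k l)

/-- The sum of absolute values for the partition function of the small objects in the presence
of large objects at `x`. -/
def screenedAbsSum (v : X → X → ℝ≥0∞) (ρ : Measure X) (zs : X → ℂ) {k : ℕ} (x : Fin k → X) :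
    ℝ≥0∞ :=
  ∑' l : ℕ, ((l ! : ℕ) : ℝ≥0∞)⁻¹ * ∫⁻ y, ‖boltzmann v l y * ∏ i, screenedActivity v zs x (y i)‖ₑ
    ∂(Measure.pi fun _ : Fin l => ρ)

/-- The partition function of the small objects in the presence of large objects at `x`. -/
def screenedSum (v : X → X → ℝ≥0∞) (ρ : Measure X) (zs : X → ℂ) {k : ℕ} (x : Fin k → X) : ℂ :=
  ∑' l, boltzmannCoeff v ρ (screenedActivity v zs x) l

lemma tsum_lintegral_eq_tsum_twoSpecies (hv : Measurable (Function.uncurry v))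
    (hsymm : ∀ x y, v x y = v y x) {z zl zs : X → ℂ} (hzl : Measurable zl) (hzs : Measurable zs)
    (hz : ∀ x, ‖z x‖ₑ = ‖zl x‖ₑ + ‖zs x‖ₑ) :
    ∑' n : ℕ, ((n ! : ℕ) : ℝ≥0∞)⁻¹ * ∫⁻ x, ‖boltzmann v n x * ∏ i, z (x i)‖ₑ
        ∂(Measure.pi fun _ : Fin n => ρ) =
      ∑' k : ℕ, ∑' l : ℕ, (((k ! : ℕ) : ℝ≥0∞)⁻¹ * ((l ! : ℕ) : ℝ≥0∞)⁻¹) *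
        ∫⁻ p, ‖twoSpecies v zl zs k l p‖ₑ
          ∂((Measure.pi fun _ => ρ).prod (Measure.pi fun _ => ρ)) := by
  rw [← ennreal_tsum_sum_range]
  refine tsum_congr fun n => ?_
  have h : ∫⁻ x, ‖boltzmann v n x * ∏ i, z (x i)‖ₑ ∂(Measure.pi fun _ : Fin n => ρ) =
      ∑ U : Finset (Fin n), ∫⁻ p, ‖twoSpecies v zl zs U.card Uᶜ.card p‖ₑ
        ∂((Measure.pi fun _ => ρ).prod (Measure.pi fun _ => ρ)) := by
    simp only [enorm_boltzmann_mul_eq_sum hsymm hz]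
    rw [lintegral_finsetSum]
    · refine Finset.sum_congr rfl fun U _ => ?_
      obtain ⟨Φ, hfun, hmp⟩ := measurePreserving_split ρ (complEquiv U)
      rw [← hmp.lintegral_comp_emb Φ.measurableEmbedding]
      simp only [hfun]
    · exact fun U _ => ((measurable_twoSpecies hv hzl hzs _ _).comp
        ((measurable_comp_index _).prodMk (measurable_comp_index _))).enorm
  rw [h, sum_finset_fin_card n fun k l => ∫⁻ p, ‖twoSpecies v zl zs k l p‖ₑ
        ∂((Measure.pi fun _ => ρ).prod (Measure.pi fun _ => ρ)), Finset.mul_sum]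
  refine Finset.sum_congr rfl fun k hk => ?_
  have := inv_factorial_mul_choose (Nat.lt_succ_iff.1 (Finset.mem_range.1 hk)) 1
    (∫⁻ p, ‖twoSpecies v zl zs k (n - k) p‖ₑ
        ∂((Measure.pi fun _ => ρ).prod (Measure.pi fun _ => ρ)))
  rw [one_mul, mul_one] at this
  rw [nsmul_eq_mul, this, mul_assoc]

/-- Tonelli: the small objects are integrated and their number summed at fixed large objects. -/
lemma tsum_lintegral_twoSpecies (hv : Measurable (Function.uncurry v)) {zl zs : X → ℂ}
    (hzl : Measurable zl) (hzs : Measurable zs) (k : ℕ) :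
    ∑' l : ℕ, (((k ! : ℕ) : ℝ≥0∞)⁻¹ * ((l ! : ℕ) : ℝ≥0∞)⁻¹) *
        ∫⁻ p, ‖twoSpecies v zl zs k l p‖ₑ
          ∂((Measure.pi fun _ => ρ).prod (Measure.pi fun _ => ρ)) =
      ((k ! : ℕ) : ℝ≥0∞)⁻¹ * ∫⁻ x, ‖boltzmann v k x * ∏ i, zl (x i)‖ₑ * screenedAbsSum v ρ zs x
        ∂(Measure.pi fun _ => ρ) := by
  have hm : ∀ l, Measurable fun p : (Fin k → X) × (Fin l → X) =>
      ‖boltzmann v l p.2 * ∏ i, screenedActivity v zs p.1 (p.2 i)‖ₑ := fun l =>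
    (measurable_boltzmann_screened hv hzs k l).enorm
  have hm' : ∀ l : ℕ, Measurable fun x : Fin k → X => ((l ! : ℕ) : ℝ≥0∞)⁻¹ *
      ∫⁻ y, ‖boltzmann v l y * ∏ i, screenedActivity v zs x (y i)‖ₑ
        ∂(Measure.pi fun _ : Fin l => ρ) := fun l =>
    (Measurable.lintegral_prod_right' (hm l)).const_mul _
  have hm'' : Measurable fun x : Fin k → X => ‖boltzmann v k x * ∏ i, zl (x i)‖ₑ :=
    ((measurable_boltzmann hv k).mul (measurable_prod_comp hzl k)).enorm
  simp only [mul_assoc, ENNReal.tsum_mul_left]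
  congr 1
  simp only [screenedAbsSum, ← ENNReal.tsum_mul_left]
  have hm3 : ∀ l : ℕ, AEMeasurable (fun x : Fin k → X => ‖boltzmann v k x * ∏ i, zl (x i)‖ₑ *
      (((l ! : ℕ) : ℝ≥0∞)⁻¹ * ∫⁻ y, ‖boltzmann v l y * ∏ i, screenedActivity v zs x (y i)‖ₑ
        ∂(Measure.pi fun _ : Fin l => ρ))) (Measure.pi fun _ => ρ) := fun l =>
    (hm''.mul (hm' l)).aemeasurable
  rw [lintegral_tsum hm3]
  refine tsum_congr fun l => ?_
  rw [lintegral_prod _ (measurable_twoSpecies hv hzl hzs k l).enorm.aemeasurable,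
    ← lintegral_const_mul' _ _ (by simp [l.factorial_ne_zero])]
  refine lintegral_congr fun x => ?_
  rw [mul_left_comm]
  congr 1
  have hm4 : Measurable fun y : Fin l → X =>
      ‖boltzmann v l y * ∏ i, screenedActivity v zs x (y i)‖ₑ :=
    Measurable.comp (f := fun y : Fin l → X => (x, y)) (hm l) measurable_prodMk_left
  rw [← lintegral_const_mul _ hm4]
  refine lintegral_congr fun y => ?_
  rw [twoSpecies, enorm_mul]

/-- The terms of `screenedSum` as functions of the positions of the large objects. -/
lemma measurable_boltzmannCoeff_screened (hv : Measurable (Function.uncurry v)) {zs : X → ℂ}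
    (hzs : Measurable zs) (k l : ℕ) : Measurable fun x : Fin k → X =>
      boltzmannCoeff v ρ (screenedActivity v zs x) l := by
  have hm := measurable_boltzmann_screened hv hzs k l
  exact (hm.stronglyMeasurable.integral_prod_right').measurable.const_mul _

omit [SigmaFinite ρ] in
lemma enorm_screenedSum_le {zs : X → ℂ} {k : ℕ} (x : Fin k → X) :
    ‖screenedSum v ρ zs x‖ₑ ≤ screenedAbsSum v ρ zs x :=
  (enorm_tsum_le_tsum_enorm ..).trans (ENNReal.tsum_le_tsum fun l => enorm_boltzmannCoeff_le l)

lemma measurable_screenedSum (hv : Measurable (Function.uncurry v)) {zs : X → ℂ}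
    (hzs : Measurable zs) (hfin : ∫⁻ x, ‖zs x‖ₑ ∂ρ < ∞) (k : ℕ) :
    Measurable fun x : Fin k → X => screenedSum v ρ zs x := by
  refine measurable_of_tendsto_metrizable (f := fun N (x : Fin k → X) =>
    ∑ l ∈ Finset.range N, boltzmannCoeff v ρ (screenedActivity v zs x) l)
    (fun N => Finset.measurable_sum _ fun l _ => measurable_boltzmannCoeff_screened hv hzs k l)
    (tendsto_pi_nhds.2 fun x => ?_)
  refine (Summable.hasSum ?_).tendsto_sum_nat
  have h := tsum_lintegral_boltzmann_lt_top (v := v) hzs.enorm hfin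
    (enorm_screenedActivity_le (v := v) zs x)
  refine Summable.of_norm ((ENNReal.summable_toReal h.ne).of_nonneg_of_le
    (fun _ => norm_nonneg _) fun l => ?_)
  rw [← toReal_enorm]
  exact ENNReal.toReal_mono (ENNReal.ne_top_of_tsum_ne_top h.ne l) (enorm_boltzmannCoeff_le l)

/-- Integration over the small objects. -/
lemma tsum_boltzmannCoeff_eq_screened (hv : Measurable (Function.uncurry v))
    (hsymm : ∀ x y, v x y = v y x) {z zl zs : X → ℂ} (hzl : Measurable zl) (hzs : Measurable zs)
    (hz : ∀ x, z x = zl x + zs x) (hz' : ∀ x, ‖z x‖ₑ = ‖zl x‖ₑ + ‖zs x‖ₑ)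
    (hfin : ∑' n : ℕ, ((n ! : ℕ) : ℝ≥0∞)⁻¹ * ∫⁻ x, ‖boltzmann v n x * ∏ i, z (x i)‖ₑ
        ∂(Measure.pi fun _ : Fin n => ρ) < ∞) :
    ∑' n, boltzmannCoeff v ρ z n = ∑' k : ℕ, ((k ! : ℕ) : ℂ)⁻¹ *
      ∫ x, (boltzmann v k x * ∏ i, zl (x i)) * screenedSum v ρ zs x
        ∂(Measure.pi fun _ : Fin k => ρ) := by
  rw [tsum_lintegral_eq_tsum_twoSpecies hv hsymm hzl hzs hz'] at hfin
  have hk : ∀ k, ∑' l : ℕ, (((k ! : ℕ) : ℝ≥0∞)⁻¹ * ((l ! : ℕ) : ℝ≥0∞)⁻¹) *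
        ∫⁻ p, ‖twoSpecies v zl zs k l p‖ₑ
          ∂((Measure.pi fun _ => ρ).prod (Measure.pi fun _ => ρ)) ≠ ∞ := fun k =>
    ENNReal.ne_top_of_tsum_ne_top hfin.ne k
  have hint : ∀ k l, Integrable (twoSpecies v zl zs k l)
      ((Measure.pi fun _ => ρ).prod (Measure.pi fun _ => ρ)) := fun k l => by
    refine ⟨(measurable_twoSpecies hv hzl hzs k l).aestronglyMeasurable, ?_⟩
    have := ENNReal.ne_top_of_tsum_ne_top (hk k) l
    rw [HasFiniteIntegral, lt_top_iff_ne_top]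
    intro h
    rw [h, ENNReal.mul_top (mul_ne_zero (by simp) (by simp))] at this
    exact this rfl
  -- The contribution of k large and l small objects; the choice of which n coordinates are large
  -- has been absorbed in the factorials.
  set H : ℕ → ℕ → ℂ := fun k l => (((k ! : ℕ) : ℂ)⁻¹ * ((l ! : ℕ) : ℂ)⁻¹) *
    ∫ p, twoSpecies v zl zs k l p ∂((Measure.pi fun _ => ρ).prod (Measure.pi fun _ => ρ)) with hH
  have hHle : ∀ k l, ‖H k l‖ₑ ≤ (((k ! : ℕ) : ℝ≥0∞)⁻¹ * ((l ! : ℕ) : ℝ≥0∞)⁻¹) *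
        ∫⁻ p, ‖twoSpecies v zl zs k l p‖ₑ
          ∂((Measure.pi fun _ => ρ).prod (Measure.pi fun _ => ρ)) := fun k l => by
    rw [hH]
    dsimp only
    rw [enorm_mul, enorm_mul, enorm_inv_natCast k.factorial_ne_zero,
      enorm_inv_natCast l.factorial_ne_zero]
    gcongr
    exact enorm_integral_le_lintegral_enorm _
  have h1 : ∀ n, boltzmannCoeff v ρ z n = ∑ k ∈ Finset.range (n + 1), H k (n - k) := by
    intro n
    have h : ∫ x, boltzmann v n x * ∏ i, z (x i) ∂(Measure.pi fun _ : Fin n => ρ) =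
        ∑ U : Finset (Fin n), ∫ p, twoSpecies v zl zs U.card Uᶜ.card p
          ∂((Measure.pi fun _ => ρ).prod (Measure.pi fun _ => ρ)) := by
      simp only [boltzmann_mul_eq_sum hsymm hz]
      have hmp := fun U : Finset (Fin n) => measurePreserving_split ρ (complEquiv U)
      choose Φ hfun hmp using hmp
      rw [integral_finsetSum]
      · refine Finset.sum_congr rfl fun U _ => ?_
        rw [← (hmp U).integral_comp (Φ U).measurableEmbedding]
        simp only [hfun]
      · intro U _
        have := ((hmp U).integrable_comp_emb (Φ U).measurableEmbedding).2 (hint _ _)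
        simpa only [Function.comp_def, hfun] using! this
    rw [boltzmannCoeff, h, sum_finset_fin_card n fun k l => ∫ p, twoSpecies v zl zs k l p
          ∂((Measure.pi fun _ => ρ).prod (Measure.pi fun _ => ρ)), Finset.mul_sum]
    refine Finset.sum_congr rfl fun k hk => ?_
    have := inv_factorial_mul_choose_complex (Nat.lt_succ_iff.1 (Finset.mem_range.1 hk)) 1
      (∫ p, twoSpecies v zl zs k (n - k) p
          ∂((Measure.pi fun _ => ρ).prod (Measure.pi fun _ => ρ)))
    rw [one_mul, mul_one] at this
    rw [nsmul_eq_mul, this, ← mul_assoc]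
  have hHfin : ∑' k, ∑' l, ‖H k l‖ₑ < ∞ :=
    (ENNReal.tsum_le_tsum fun k => ENNReal.tsum_le_tsum fun l => hHle k l).trans_lt hfin
  simp only [h1]
  rw [complex_tsum_sum_range hHfin]
  refine tsum_congr fun k => ?_
  have h2 : ∀ (l : ℕ) (x : Fin k → X), ((l ! : ℕ) : ℂ)⁻¹ *
      ∫ y, twoSpecies v zl zs k l (x, y) ∂(Measure.pi fun _ => ρ) =
      (boltzmann v k x * ∏ i, zl (x i)) * boltzmannCoeff v ρ (screenedActivity v zs x) l := by
    intro l x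
    simp only [twoSpecies]
    rw [integral_const_mul, boltzmannCoeff]
    ring
  have hint' : ∀ l : ℕ, Integrable (fun x : Fin k → X => (boltzmann v k x * ∏ i, zl (x i)) *
      boltzmannCoeff v ρ (screenedActivity v zs x) l) (Measure.pi fun _ => ρ) := fun l => by
    simp only [← h2]
    exact (hint k l).integral_prod_left.const_mul _
  have h3 : ∀ l, H k l = ((k ! : ℕ) : ℂ)⁻¹ * ∫ x, (boltzmann v k x * ∏ i, zl (x i)) *
      boltzmannCoeff v ρ (screenedActivity v zs x) l ∂(Measure.pi fun _ : Fin k => ρ) := by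
    intro l
    simp only [← h2]
    rw [integral_const_mul, ← integral_prod _ (hint k l), ← mul_assoc]
  simp only [h3]
  rw [tsum_mul_left]
  congr 1
  -- This justifies exchanging the sum over the number of small objects with the integral over the
  -- large ones.
  have hsum : Summable fun l : ℕ => ∫ x, ‖(boltzmann v k x * ∏ i, zl (x i)) *
      boltzmannCoeff v ρ (screenedActivity v zs x) l‖ ∂(Measure.pi fun _ : Fin k => ρ) := by
    have hk' := hk k
    rw [tsum_lintegral_twoSpecies hv hzl hzs] at hk'
    have htop : ∑' l : ℕ, ∫⁻ x, ‖(boltzmann v k x * ∏ i, zl (x i)) *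
        boltzmannCoeff v ρ (screenedActivity v zs x) l‖ₑ ∂(Measure.pi fun _ : Fin k => ρ) ≠ ∞ := by
      rw [← lintegral_tsum fun l => (hint' l).aestronglyMeasurable.enorm]
      refine ne_top_of_le_ne_top (b := ∫⁻ x, ‖boltzmann v k x * ∏ i, zl (x i)‖ₑ *
        screenedAbsSum v ρ zs x ∂(Measure.pi fun _ => ρ)) ?_ (lintegral_mono fun x => ?_)
      · intro h
        rw [h, ENNReal.mul_top (by simp)] at hk'
        exact hk' rfl
      · simp only [enorm_mul (_ * _) (boltzmannCoeff _ _ _ _), ENNReal.tsum_mul_left]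
        gcongr
        exact ENNReal.tsum_le_tsum fun l => enorm_boltzmannCoeff_le l
    have := ENNReal.summable_toReal htop
    simpa only [← integral_norm_eq_lintegral_enorm (hint' _).aestronglyMeasurable] using this
  rw [(hasSum_integral_of_summable_integral_norm hint' hsum).tsum_eq]
  simp only [tsum_mul_left]
  rfl

end TwoSpecies

/-! ### Effective activities, effective interactions and the main identity -/

section Effective

variable {X : Type*} [MeasurableSpace X] {v : X → X → ℝ≥0∞} {μ : DensityMeasure X}
  {Xs Xl : Set X}

lemma setLIntegral_tv (hμ : Measurable μ.density) {S : Set X} (hS : MeasurableSet S)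
    {g : X → ℝ≥0∞} (hg : Measurable g) :
    ∫⁻ y in S, g y ∂μ.tv = ∫⁻ y, ‖S.indicator μ.density y‖ₑ * g y ∂μ.base := by
  rw [DensityMeasure.tv, restrict_withDensity hS,
    lintegral_withDensity_eq_lintegral_mul _ hμ.enorm hg, ← lintegral_indicator hS]
  refine lintegral_congr fun y => ?_
  by_cases hy : y ∈ S <;> simp [hy]

omit [MeasurableSpace X] in
lemma indicator_union_eq_add (hdisj : Disjoint Xs Xl) (z : X → ℂ) (x : X) :
    (Xs ∪ Xl).indicator z x = Xl.indicator z x + Xs.indicator z x := by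
  rw [Set.indicator_union_of_disjoint hdisj, add_comm]

omit [MeasurableSpace X] in
lemma enorm_indicator_union_eq_add (hdisj : Disjoint Xs Xl) (z : X → ℂ) (x : X) :
    ‖(Xs ∪ Xl).indicator z x‖ₑ = ‖Xl.indicator z x‖ₑ + ‖Xs.indicator z x‖ₑ := by
  simp only [enorm_indicator_eq_indicator_enorm]
  rw [Set.indicator_union_of_disjoint hdisj, add_comm]

/-- The effective activity before restriction to the large objects. -/
def effectiveDensityMeasure (v : X → X → ℝ≥0∞) (μ : DensityMeasure X) (Xs : Set X) :
    DensityMeasure X where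
  base := μ.base
  density x := Complex.exp ((cloudMeasure v μ Xs).integral (zeta v x)) * μ.density x

lemma effectiveActivity_eq_restrict :
    effectiveActivity v μ Xs Xl = (effectiveDensityMeasure v μ Xs).restrict Xl := rfl

variable [SigmaFinite μ.base]

instance : SigmaFinite (effectiveDensityMeasure v μ Xs).base := ‹SigmaFinite μ.base›

omit [MeasurableSpace X] in
lemma screenedActivity_zero (z : X → ℂ) (x : Fin 0 → X) : screenedActivity v z x = z := by
  funext y
  simp [screenedActivity]

lemma partitionFunction_eq_screenedSum (hXs : MeasurableSet Xs) (x : Fin 0 → X) :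
    partitionFunction v μ Xs = screenedSum v μ.base (Xs.indicator μ.density) x := by
  rw [partitionFunction, restrict_gcSum μ hXs, screenedSum, screenedActivity_zero]

section Convergent

variable (hv : Measurable (Function.uncurry v)) (hsymm : ∀ x y, v x y = v y x)
  (hμ : Measurable μ.density) (hXs : MeasurableSet Xs)
  (hfin : ∫⁻ x, ‖Xs.indicator μ.density x‖ₑ ∂μ.base < ∞)
  (hcs : CloudSummable v μ.base fun x => ‖Xs.indicator μ.density x‖ₑ)
include hv hsymm hμ hXs hfin hcs

lemma screenedSum_eq_exp {m : ℕ} (x : Fin m → X) :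
    screenedSum v μ.base (Xs.indicator μ.density) x =
      Complex.exp ((cloudMeasure v μ Xs).integral fun Y => ∏ j, (1 + zeta v (x j) Y)) := by
  have hz : Measurable (Xs.indicator μ.density) := hμ.indicator hXs
  have hu : Measurable (screenedActivity v (Xs.indicator μ.density) x) :=
    Measurable.comp (f := fun y : X => (x, y)) (measurable_screenedActivity hv hz m)
      measurable_prodMk_left
  rw [screenedSum, tsum_boltzmannCoeff_eq_exp hv hsymm hz.enorm hfin hcs hu
    (enorm_screenedActivity_le _ x), tsum_clusterCoeff_screenedActivity hv hμ hXs hcs]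

lemma partitionFunction_eq_exp :
    partitionFunction v μ Xs = Complex.exp ((cloudMeasure v μ Xs).integral fun _ => 1) := by
  rw [partitionFunction_eq_screenedSum hXs Fin.elim0,
    screenedSum_eq_exp hv hsymm hμ hXs hfin hcs]
  simp

lemma partitionFunction_ne_zero : partitionFunction v μ Xs ≠ 0 := by
  rw [partitionFunction_eq_exp hv hsymm hμ hXs hfin hcs]
  exact Complex.exp_ne_zero _

/-- The pointwise form of the theorem: by the exponential formula and the subset expansion of the
cloud integral, the quotient of the screened by the unscreened partition function is the product of
the exponentials of the one-body and many-body terms. -/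
lemma effectiveBoltzmann_mul_prod {m : ℕ} (x : Fin m → X) :
    effectiveBoltzmann v μ Xs m x *
        ∏ i, Xl.indicator (effectiveDensityMeasure v μ Xs).density (x i) =
      (boltzmann v m x * ∏ i, Xl.indicator μ.density (x i)) *
        screenedSum v μ.base (Xs.indicator μ.density) x * (partitionFunction v μ Xs)⁻¹ := by
  have h1 : ∀ y, Xl.indicator (effectiveDensityMeasure v μ Xs).density y =
      Complex.exp ((cloudMeasure v μ Xs).integral (zeta v y)) * Xl.indicator μ.density y := by
    intro y
    by_cases hy : y ∈ Xl <;> simp [hy, effectiveDensityMeasure]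
  simp only [h1, Finset.prod_mul_distrib]
  rw [screenedSum_eq_exp hv hsymm hμ hXs hfin hcs, partitionFunction_eq_exp hv hsymm hμ hXs hfin hcs,
    cloud_integral_prod_one_add_zeta hv hμ hXs hcs, effectiveBoltzmann, Complex.exp_add,
    sub_eq_add_neg, Complex.exp_add, Complex.exp_sum]
  have := Complex.exp_ne_zero ((cloudMeasure v μ Xs).integral fun _ => 1)
  field_simp

/-- By the pointwise identity and the triangle inequality for the screened sum, the effective series
is dominated by the full absolute series divided by |Z| of the small objects. -/
lemma effective_gcAbsConvergent (hXl : MeasurableSet Xl)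
    (hdisj : Disjoint Xs Xl)
    (hfull : (μ.restrict (Xs ∪ Xl)).GCAbsConvergent (boltzmann v)) :
    (effectiveActivity v μ Xs Xl).GCAbsConvergent (effectiveBoltzmann v μ Xs) := by
  have hzs : Measurable (Xs.indicator μ.density) := hμ.indicator hXs
  have hzl : Measurable (Xl.indicator μ.density) := hμ.indicator hXl
  have hZ := partitionFunction_ne_zero hv hsymm hμ hXs hfin hcs
  have hZe : ‖(partitionFunction v μ Xs)⁻¹‖ₑ ≠ ∞ := enorm_ne_top
  have hsum : ∑' k : ℕ, ((k ! : ℕ) : ℝ≥0∞)⁻¹ *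
      ∫⁻ x, ‖boltzmann v k x * ∏ i, Xl.indicator μ.density (x i)‖ₑ *
        screenedAbsSum v μ.base (Xs.indicator μ.density) x
        ∂(Measure.pi fun _ : Fin k => μ.base) < ∞ := by
    have := hfull.2
    rw [restrict_gcAbsSum μ (hXs.union hXl), tsum_lintegral_eq_tsum_twoSpecies hv hsymm hzl hzs
      (enorm_indicator_union_eq_add hdisj _)] at this
    simpa only [tsum_lintegral_twoSpecies hv hzl hzs] using this
  have hle : ∀ k : ℕ, ∫⁻ x, ‖effectiveBoltzmann v μ Xs k x *
      ∏ i, Xl.indicator (effectiveDensityMeasure v μ Xs).density (x i)‖ₑ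
        ∂(Measure.pi fun _ : Fin k => μ.base) ≤
      (∫⁻ x, ‖boltzmann v k x * ∏ i, Xl.indicator μ.density (x i)‖ₑ *
        screenedAbsSum v μ.base (Xs.indicator μ.density) x
        ∂(Measure.pi fun _ : Fin k => μ.base)) * ‖(partitionFunction v μ Xs)⁻¹‖ₑ := by
    intro k
    rw [← lintegral_mul_const' _ _ hZe]
    refine lintegral_mono fun x => ?_
    dsimp only
    rw [effectiveBoltzmann_mul_prod hv hsymm hμ hXs hfin hcs, enorm_mul, enorm_mul]
    gcongr
    exact enorm_screenedSum_le x
  rw [effectiveActivity_eq_restrict]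
  refine ⟨fun k => ?_, ?_⟩
  · rw [restrict_pow_absIntegrable _ hXl]
    refine ⟨?_, (hle k).trans_lt (ENNReal.mul_lt_top ?_ hZe.lt_top)⟩
    · have hm : Measurable fun x : Fin k → X =>
          (boltzmann v k x * ∏ i, Xl.indicator μ.density (x i)) *
          screenedSum v μ.base (Xs.indicator μ.density) x * (partitionFunction v μ Xs)⁻¹ :=
        (((measurable_boltzmann hv k).mul (measurable_prod_comp hzl k)).mul
          (measurable_screenedSum hv hzs hfin k)).mul_const _
      simp only [effectiveBoltzmann_mul_prod hv hsymm hμ hXs hfin hcs]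
      exact hm.aestronglyMeasurable
    · have := ENNReal.ne_top_of_tsum_ne_top hsum.ne k
      rw [lt_top_iff_ne_top]
      intro h
      rw [h, ENNReal.mul_top (by simp)] at this
      exact this rfl
  · rw [restrict_gcAbsSum _ hXl]
    refine (ENNReal.tsum_le_tsum fun k => mul_le_mul_right (hle k) _).trans_lt ?_
    simp only [← mul_assoc]
    rw [ENNReal.tsum_mul_right]
    exact ENNReal.mul_lt_top hsum hZe.lt_top

lemma partitionFunction_div_eq (hXl : MeasurableSet Xl) (hdisj : Disjoint Xs Xl)
    (hfull : (μ.restrict (Xs ∪ Xl)).GCAbsConvergent (boltzmann v)) :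
    partitionFunction v μ (Xs ∪ Xl) / partitionFunction v μ Xs =
      (effectiveActivity v μ Xs Xl).gcSum (effectiveBoltzmann v μ Xs) := by
  have hfull' := hfull.2
  rw [restrict_gcAbsSum μ (hXs.union hXl)] at hfull'
  rw [partitionFunction, restrict_gcSum μ (hXs.union hXl),
    tsum_boltzmannCoeff_eq_screened hv hsymm (hμ.indicator hXl) (hμ.indicator hXs)
      (indicator_union_eq_add hdisj _) (enorm_indicator_union_eq_add hdisj _) hfull',
    effectiveActivity_eq_restrict, DensityMeasure.gcSum, div_eq_mul_inv, ← tsum_mul_right]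
  refine tsum_congr fun k => ?_
  rw [restrict_pow_integral _ hXl]
  simp only [effectiveBoltzmann_mul_prod hv hsymm hμ hXs hfin hcs]
  rw [integral_mul_const, mul_assoc]
  rfl

end Convergent

section Nonnegative

lemma eq_norm_of_nonneg {w : ℂ} (h : ∃ r : ℝ, 0 ≤ r ∧ w = r) : w = (‖w‖ : ℂ) := by
  obtain ⟨r, hr, rfl⟩ := h
  rw [Complex.norm_of_nonneg hr]

variable (hpos : ∀ x, μ.density x = (‖μ.density x‖ : ℂ))
include hpos

omit [SigmaFinite μ.base] in
-- For nonnegative μ the cloud measure is signed but real, so all exponents are real and their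
-- exponentials positive. No integrability is required: the complex and real integrals agree under
-- the default value as well.
lemma exists_cloud_integral_eq_ofReal {h : Cloud X → ℂ} {h' : Cloud X → ℝ}
    (hh : ∀ Y, h Y = (h' Y : ℂ)) : ∃ r : ℝ, (cloudMeasure v μ Xs).integral h = (r : ℂ) := by
  refine ⟨∫ Y, h' Y * (ursell v (Y.1 + 1) Y.2 * ∏ i, ‖μ.density (Y.2 i)‖)
    ∂(cloudMeasure v μ Xs).base, ?_⟩
  rw [DensityMeasure.integral, ← integral_complex_ofReal]
  refine integral_congr_ae (.of_forall fun Y => ?_)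
  have : (cloudMeasure v μ Xs).density Y =
      (ursell v (Y.1 + 1) Y.2 : ℂ) * ∏ i, μ.density (Y.2 i) := rfl
  simp only [this, hh]
  push_cast
  simp only [← hpos]

omit [SigmaFinite μ.base] in
lemma effectiveActivity_density_nonneg (x : X) :
    (effectiveActivity v μ Xs Xl).density x =
      (‖(effectiveActivity v μ Xs Xl).density x‖ : ℂ) := by
  obtain ⟨r, hr⟩ := exists_cloud_integral_eq_ofReal (v := v) (Xs := Xs) hpos
    (h := zeta v x) fun Y => rfl
  refine eq_norm_of_nonneg ⟨Real.exp r * ‖μ.density x‖, by positivity, ?_⟩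
  have : (effectiveActivity v μ Xs Xl).density x =
      Complex.exp ((cloudMeasure v μ Xs).integral (zeta v x)) * μ.density x := rfl
  rw [this, hr, Complex.ofReal_mul, Complex.ofReal_exp, ← hpos]

omit [SigmaFinite μ.base] in
lemma effectiveBoltzmann_nonneg (m : ℕ) (x : Fin m → X) :
    effectiveBoltzmann v μ Xs m x = (‖effectiveBoltzmann v μ Xs m x‖ : ℂ) := by
  have h : ∀ J : Finset (Fin m), ∃ r : ℝ,
      multibodyW v μ Xs (fun j : {j // j ∈ J} => x j) = (r : ℂ) := by
    intro J
    obtain ⟨r, hr⟩ := exists_cloud_integral_eq_ofReal (v := v) (Xs := Xs) hpos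
      (h := fun Y => ∏ j : {j // j ∈ J}, zeta v (x j) Y)
      (h' := fun Y => ∏ j : {j // j ∈ J}, ((∏ i, (1 + mayer v (x j) (Y.2 i))) - 1))
      fun Y => by simp only [zeta, Complex.ofReal_prod]
    exact ⟨-r, by rw [multibodyW, hr, Complex.ofReal_neg]⟩
  choose r hr using h
  obtain ⟨b, hb, hb'⟩ := boltzmann_mem (v := v) m x
  refine eq_norm_of_nonneg ⟨b * Real.exp (-∑ J : Finset (Fin m) with 2 ≤ J.card, r J),
    mul_nonneg hb.1 (Real.exp_pos _).le, ?_⟩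
  rw [effectiveBoltzmann, hb']
  simp only [hr]
  push_cast
  rfl

omit [SigmaFinite μ.base] in
lemma screenedActivity_nonneg {m : ℕ} (x : Fin m → X) (y : X) :
    screenedActivity v (Xs.indicator μ.density) x y =
      (‖screenedActivity v (Xs.indicator μ.density) x y‖ : ℂ) := by
  refine eq_norm_of_nonneg ⟨(∏ j, (1 + mayer v (x j) y)) * Xs.indicator (fun y => ‖μ.density y‖) y,
    mul_nonneg (Finset.prod_nonneg fun j _ => (one_add_mayer_mem v _ _).1)
      (Set.indicator_nonneg (fun _ _ => norm_nonneg _) _), ?_⟩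
  rw [screenedActivity, Complex.ofReal_mul, Complex.ofReal_prod]
  congr 1
  by_cases hy : y ∈ Xs <;> simp [hy, ← hpos]

lemma enorm_screenedSum (hv : Measurable (Function.uncurry v)) (hμ : Measurable μ.density)
    (hXs : MeasurableSet Xs) (hfin : ∫⁻ x, ‖Xs.indicator μ.density x‖ₑ ∂μ.base < ∞)
    {m : ℕ} (x : Fin m → X) :
    ‖screenedSum v μ.base (Xs.indicator μ.density) x‖ₑ =
      screenedAbsSum v μ.base (Xs.indicator μ.density) x := by
  have hz : Measurable (Xs.indicator μ.density) := hμ.indicator hXs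
  have hu : Measurable (screenedActivity v (Xs.indicator μ.density) x) :=
    Measurable.comp (f := fun y : X => (x, y)) (measurable_screenedActivity hv hz m)
      measurable_prodMk_left
  exact enorm_tsum_boltzmannCoeff hv hz.enorm hfin hu (enorm_screenedActivity_le _ x)
    (screenedActivity_nonneg hpos x)

/-- For nonnegative activities the screened sum equals its own absolute sum, so the estimate of
`effective_gcAbsConvergent` becomes an equality term by term, finite or not. -/
lemma gcAbsSum_div_eq (hv : Measurable (Function.uncurry v)) (hsymm : ∀ x y, v x y = v y x)
    (hμ : Measurable μ.density) (hXs : MeasurableSet Xs)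
    (hfin : ∫⁻ x, ‖Xs.indicator μ.density x‖ₑ ∂μ.base < ∞)
    (hcs : CloudSummable v μ.base fun x => ‖Xs.indicator μ.density x‖ₑ)
    (hXl : MeasurableSet Xl) (hdisj : Disjoint Xs Xl) :
    (μ.restrict (Xs ∪ Xl)).gcAbsSum (boltzmann v) / (μ.restrict Xs).gcAbsSum (boltzmann v) =
      (effectiveActivity v μ Xs Xl).gcAbsSum (effectiveBoltzmann v μ Xs) := by
  have hzs : Measurable (Xs.indicator μ.density) := hμ.indicator hXs
  have hzl : Measurable (Xl.indicator μ.density) := hμ.indicator hXl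
  have hZ := partitionFunction_ne_zero hv hsymm hμ hXs hfin hcs
  -- The divisor is the norm of a nonzero complex number, so division in [0, ∞] is multiplication by
  -- a finite inverse.
  have h1 : (μ.restrict Xs).gcAbsSum (boltzmann v) = ‖partitionFunction v μ Xs‖ₑ := by
    rw [partitionFunction_eq_screenedSum hXs Fin.elim0, enorm_screenedSum hpos hv hμ hXs hfin,
      restrict_gcAbsSum μ hXs, screenedAbsSum, screenedActivity_zero]
  rw [h1, restrict_gcAbsSum μ (hXs.union hXl), tsum_lintegral_eq_tsum_twoSpecies hv hsymm hzl hzs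
      (enorm_indicator_union_eq_add hdisj _), effectiveActivity_eq_restrict,
    restrict_gcAbsSum _ hXl, div_eq_mul_inv, ← ENNReal.tsum_mul_right, ← enorm_inv hZ]
  refine tsum_congr fun k => ?_
  rw [tsum_lintegral_twoSpecies hv hzl hzs, mul_assoc, ← lintegral_mul_const' _ _ enorm_ne_top]
  congr 1
  refine lintegral_congr fun x => ?_
  rw [effectiveBoltzmann_mul_prod hv hsymm hμ hXs hfin hcs]
  simp only [enorm_mul, enorm_screenedSum hpos hv hμ hXs hfin]

end Nonnegative

end Effective

end TwoScale
end

/-! ### The effective partition function -/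

theorem mainTheorem7 {X : Type*} [MeasurableSpace X]
    (v : X → X → ℝ≥0∞) (hv_meas : Measurable (Function.uncurry v))
    (hv_symm : ∀ x y, v x y = v y x)
    (μ : TwoScale.DensityMeasure X) [SigmaFinite μ.base] (hμ : Measurable μ.density)
    (Xs Xl : Set X) (hXs : MeasurableSet Xs) (hXl : MeasurableSet Xl)
    (hdisj : Disjoint Xs Xl) (hunion : Xs ∪ Xl = Set.univ)
    (c : X → ℝ≥0) (hc : Measurable c)
    (hconv : ∀ y ∈ Xs, ∫⁻ y' in Xs, ENNReal.ofReal (|TwoScale.mayer v y y'| * Real.exp (c y'))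
      ∂μ.tv ≤ c y)
    (hconv' : ∀ x ∈ Xl, ∫⁻ y in Xs, ENNReal.ofReal (|TwoScale.mayer v x y| * Real.exp (c y))
      ∂μ.tv < ∞)
    (hfinvol : ∫⁻ y in Xs, ENNReal.ofReal (Real.exp (c y)) ∂μ.tv < ∞) :
    -- the integrals defining the effective activity and interactions converge absolutely
    (∀ x ∈ Xl, (TwoScale.cloudMeasure v μ Xs).AbsIntegrable (TwoScale.zeta v x)) ∧
    (∀ (m : ℕ) (x : Fin m → X) (J : Finset (Fin m)), 2 ≤ J.card → (∀ j ∈ J, x j ∈ Xl) →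
      (TwoScale.cloudMeasure v μ Xs).AbsIntegrable
        fun Y => ∏ j : {j // j ∈ J}, TwoScale.zeta v (x j) Y) ∧
    -- the partition function of the small objects is well defined and does not vanish
    (μ.restrict Xs).GCAbsConvergent (TwoScale.boltzmann v) ∧
    TwoScale.partitionFunction v μ Xs ≠ 0 ∧
    -- the identity, whenever the full partition function converges absolutely
    ((μ.restrict (Xs ∪ Xl)).GCAbsConvergent (TwoScale.boltzmann v) →
      (TwoScale.effectiveActivity v μ Xs Xl).GCAbsConvergent
        (TwoScale.effectiveBoltzmann v μ Xs) ∧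
      TwoScale.partitionFunction v μ (Xs ∪ Xl) / TwoScale.partitionFunction v μ Xs =
        (TwoScale.effectiveActivity v μ Xs Xl).gcSum (TwoScale.effectiveBoltzmann v μ Xs)) ∧
    -- for a nonnegative measure the identity holds in `[0, ∞]` without further condition
    ((∀ x, μ.density x = (‖μ.density x‖ : ℂ)) →
      (∀ x ∈ Xl, (TwoScale.effectiveActivity v μ Xs Xl).density x =
        (‖(TwoScale.effectiveActivity v μ Xs Xl).density x‖ : ℂ)) ∧
      (∀ (m : ℕ) (x : Fin m → X), (∀ i, x i ∈ Xl) →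
        TwoScale.effectiveBoltzmann v μ Xs m x =
          (‖TwoScale.effectiveBoltzmann v μ Xs m x‖ : ℂ)) ∧
      (μ.restrict (Xs ∪ Xl)).gcAbsSum (TwoScale.boltzmann v) /
          (μ.restrict Xs).gcAbsSum (TwoScale.boltzmann v) =
        (TwoScale.effectiveActivity v μ Xs Xl).gcAbsSum (TwoScale.effectiveBoltzmann v μ Xs)) := by

  have hE : Measurable fun y => ENNReal.ofReal (Real.exp (c y)) :=
    (Real.measurable_exp.comp hc.coe_nnreal_real).ennreal_ofReal
  have hzs : Measurable (Xs.indicator μ.density) := hμ.indicator hXs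
  have hfinw : ∫⁻ y, ‖Xs.indicator μ.density y‖ₑ * ENNReal.ofReal (Real.exp (c y)) ∂μ.base < ∞ := by
    rwa [← TwoScale.setLIntegral_tv hμ hXs hE]
  -- Since c ≥ 0, the weight exp(c) is at least 1.
  have hfin : ∫⁻ y, ‖Xs.indicator μ.density y‖ₑ ∂μ.base < ∞ := by
    refine (lintegral_mono fun y => ?_).trans_lt hfinw
    refine le_mul_of_one_le_right' ?_
    rw [ENNReal.one_le_ofReal]
    exact Real.one_le_exp (c y).2
  have hKP : ∀ y ∈ Xs, ∫⁻ x, ‖TwoScale.mayer v y x‖ₑ * ‖Xs.indicator μ.density x‖ₑ *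
      ENNReal.ofReal (Real.exp (c x)) ∂μ.base ≤ c y := by
    intro y hy
    refine le_of_eq_of_le ?_ (hconv y hy)
    have hm : Measurable fun x => ENNReal.ofReal (|TwoScale.mayer v y x| * Real.exp (c x)) :=
      ((TwoScale.measurable_mayer_comp hv_meas measurable_const measurable_id).abs.mul
        (Real.measurable_exp.comp hc.coe_nnreal_real)).ennreal_ofReal
    rw [TwoScale.setLIntegral_tv hμ hXs hm]
    refine lintegral_congr fun x => ?_
    rw [ENNReal.ofReal_mul (abs_nonneg _), Real.enorm_eq_ofReal_abs]
    ring
  -- The weight |z| restricted to `Xs` vanishes off `Xs`, so the convergence condition is needed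
  -- only at small objects.
  have hcs : TwoScale.CloudSummable v μ.base fun x => ‖Xs.indicator μ.density x‖ₑ :=
    TwoScale.tsum_lintegral_ursell_lt_top hv_meas hv_symm hzs.enorm (S := Xs)
      (fun x hx => by simp [hx]) hKP hfinw
  refine ⟨fun x _ => ?_, fun m x J _ _ => ?_, ⟨fun n => ?_, ?_⟩, ?_, fun hfull => ⟨?_, ?_⟩,
    fun hpos => ⟨fun x _ => ?_, fun m x _ => ?_, ?_⟩⟩
  · exact TwoScale.cloud_absIntegrable hv_meas hμ hXs hcs (TwoScale.measurable_zeta hv_meas x)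
      (TwoScale.enorm_zeta_le_one x)
  · exact TwoScale.cloud_absIntegrable hv_meas hμ hXs hcs
      (Finset.measurable_prod _ fun j _ => TwoScale.measurable_zeta hv_meas _)
      (TwoScale.enorm_prod_zeta_le_one _ fun j : {j // j ∈ J} => x j)
  · rw [TwoScale.restrict_pow_absIntegrable μ hXs]
    exact TwoScale.integrable_boltzmann_mul hv_meas hzs.enorm hfin hzs (fun _ => le_rfl) n
  · rw [TwoScale.restrict_gcAbsSum μ hXs]
    exact TwoScale.tsum_lintegral_boltzmann_lt_top hzs.enorm hfin fun _ => le_rfl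
  · exact TwoScale.partitionFunction_ne_zero hv_meas hv_symm hμ hXs hfin hcs
  · exact TwoScale.effective_gcAbsConvergent hv_meas hv_symm hμ hXs hfin hcs hXl hdisj hfull
  · exact TwoScale.partitionFunction_div_eq hv_meas hv_symm hμ hXs hfin hcs hXl hdisj hfull
  · exact TwoScale.effectiveActivity_density_nonneg hpos x
  · exact TwoScale.effectiveBoltzmann_nonneg hpos m x
  · exact TwoScale.gcAbsSum_div_eq hpos hv_meas hv_symm hμ hXs hfin hcs hXl hdisj
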